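/- Let $d\ge 2$ and $\lambda>1$. Write $\widehat f(\xi)=(2\pi)^{-d/2}\int_{\mathbb{R}^d}e^{-ix\cdot\xi}f(x)\,dx$ for the Fourier transform, extended to $\mathcal S'(\mathbb{R}^d)$ as usual. *Littlewood–Paley projectors.* Fix $\phi\in\mathcal S(\mathbb{R}^d)$ supported in $\{|\xi|\le 2\}$ with $\phi(\xi)=1$ for $|\xi|\le 1$, put $\psi(\xi)=\phi(\xi)-\phi(2\xi)$, and for $k\in\mathbb{Z}$ let $\widehat{P_kf}(\xi)=\psi(\xi/2^k)\widehat f(\xi)$ and $\widehat{P_{\le k}f}(\xi)=\phi(\xi/2^k)\widehat f(\xi)$. *The space $Y_\lambda^*$.* Let $k_\lambda\in\mathbb{Z}$ be such that $2^{k_\lambda-1}<\lambda^{1/2}\le 2^{k_\lambda}$, let $I=\{k_\lambda-2,k_\lambda-1,k_\lambda,k_\lambda+1\}$, $P_{<I}=P_{\le k_\lambda-3}$ and $m_\lambda(\xi)=|\lambda-|\xi|^2|$. Let $D_0=\{|x|\le1\}$, $D_j=\{2^{j-1}<|x|\le 2^j\}$ for $j\ge1$, and $$|||f|||_*=\sup_{j\ge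 0}2^{-j/2}\|f\|_{L^2(D_j)} .$$ Then $Y_\lambda^*$ is the space of all $u\in\mathcal S'(\mathbb{R}^d)$ for which $$\|u\|_{Y_\lambda^*}^2=\|m_\lambda^{1/2}\widehat{P_{<I}u}\|_{L^2}^2+\sum_{k\in I}\lambda^{1/2}|||P_ku|||_*^2+\sum_{k>k_\lambda+1}\|m_\lambda^{1/2}\widehat{P_ku}\|_{L^2}^2$$ is finite (a norm of a distribution is $\infty$ if the distribution is not a locally integrable function). *The Besov space.* $\dot B^{1/2}_{2,1}(\mathbb{R}^d)$ is the space of all $f\in\mathcal S'(\mathbb{R}^d)$ with finite seminorm $\|f\|_{\dot B^{1/2}_{2,1}}=\sum_{l\in\mathbb{Z}}2^{l/2}\|P_lf\|_{L^2}$, with the topology of this seminorm. *The cutoff.* Let $\theta\in\mathcal S(\mathbb{R}^d)$ be $[0,1]$-valued, supported in $\{|\xi|\le1\}$ and not identically zero, let $\delta\in(0,1]$ be such that $$\Big|\int_{\mathbb{R}^d}e^{ix\cdot\xi}\theta(\xi)\,d\xi\Big|\ge\frac12\int_{\mathbb{R}^d}\theta(\xi)\,d\xi\quad\text{whenever }|x|\le\delta,$$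 let $R\ge1$, and put $$\chi(x)=\frac1{(2\pi)^{d/2}}\int_{\mathbb{R}^d}e^{i(\delta/R)x\cdot\xi}\theta(\xi)\,d\xi .$$ Then multiplication by $\chi$, $u\mapsto\chi u$, is a well-defined compact linear operator from $Y_\lambda^*$ to $\dot B^{1/2}_{2,1}(\mathbb{R}^d)$. -/

import Mathlib

open MeasureTheory FourierTransform
open scoped SchwartzMap ENNReal Real

noncomputable section

/-! ### Extended seminorms and the space of vectors on which they are finite -/

/-- An extended seminorm: a `[0, ∞]`-valued subadditive and absolutely homogeneous function.
(Homogeneity is recorded as an inequality; the equality follows, see `ExtSeminorm.smul_eq`.) -/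
structure ExtSeminorm (V : Type*) [AddCommGroup V] [Module ℂ V] where
  toFun : V → ℝ≥0∞
  add_le : ∀ u v, toFun (u + v) ≤ toFun u + toFun v
  smul_le : ∀ (c : ℂ) (u : V), toFun (c • u) ≤ ‖c‖ₑ * toFun u

namespace ExtSeminorm

variable {V : Type*} [AddCommGroup V] [Module ℂ V] (p : ExtSeminorm V)

theorem map_zero : p.toFun 0 = 0 := by
  have h := p.smul_le 0 0
  simpa using h

theorem smul_eq (c : ℂ) (u : V) : p.toFun (c • u) = ‖c‖ₑ * p.toFun u := by
  refine le_antisymm (p.smul_le c u) ?_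
  rcases eq_or_ne c 0 with rfl | hc
  · simp
  · have h := p.smul_le c⁻¹ (c • u)
    rw [smul_smul, inv_mul_cancel₀ hc, one_smul] at h
    calc ‖c‖ₑ * p.toFun u ≤ ‖c‖ₑ * (‖c⁻¹‖ₑ * p.toFun (c • u)) := by gcongr
      _ = p.toFun (c • u) := by
        rw [← mul_assoc, ← enorm_mul, mul_inv_cancel₀ hc, enorm_one, one_mul]

/-- The subspace of vectors with finite extended seminorm. -/
def finite : Submodule ℂ V where
  carrier := {u | p.toFun u < ∞}
  add_mem' {u v} hu hv := (p.add_le u v).trans_lt (ENNReal.add_lt_top.2 ⟨hu, hv⟩)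
  zero_mem' := by simp [p.map_zero]
  smul_mem' c u hu := (p.smul_le c u).trans_lt (ENNReal.mul_lt_top enorm_lt_top hu)

/-- The space of vectors with finite extended seminorm, with the topology of that seminorm
(and not with the topology it could inherit from the ambient space). -/
def Space : Type _ := p.finite

instance : AddCommGroup p.Space := inferInstanceAs (AddCommGroup p.finite)

instance : Module ℂ p.Space := inferInstanceAs (Module ℂ p.finite)

/-- The inclusion into the ambient space. -/
def incl : p.Space →ₗ[ℂ] V := p.finite.subtype

/-- The seminorm on the space of vectors on which it is finite. -/
def toSeminorm : Seminorm ℂ p.Space :=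
  Seminorm.of (fun u => (p.toFun (p.incl u)).toReal)
    (fun u v => by
      have hu : p.toFun (p.incl u) < ∞ := u.2
      have hv : p.toFun (p.incl v) < ∞ := v.2
      rw [_root_.map_add, ← ENNReal.toReal_add hu.ne hv.ne]
      exact ENNReal.toReal_mono (ENNReal.add_lt_top.2 ⟨hu, hv⟩).ne (p.add_le _ _))
    (fun c u => by
      rw [_root_.map_smul, p.smul_eq, ENNReal.toReal_mul]
      simp)

instance : SeminormedAddCommGroup p.Space :=
  AddGroupSeminorm.toSeminormedAddCommGroup p.toSeminorm.toAddGroupSeminorm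

theorem norm_def (u : p.Space) : ‖u‖ = (p.toFun (p.incl u)).toReal := rfl

instance : NormedSpace ℂ p.Space where
  norm_smul_le c u := (map_smul_eq_mul p.toSeminorm c u).le

end ExtSeminorm

/-! ### Norms of functions, applied to tempered distributions -/

/-- `ℝ^d` with its Euclidean norm. -/
abbrev Euc (d : ℕ) := EuclideanSpace ℝ (Fin d)

/-- The tempered distribution `T` is (given by) the locally integrable function `g`. -/
def IsGivenBy {d : ℕ} (T : 𝓢'(Euc d, ℂ)) (g : Euc d → ℂ) : Prop :=
  LocallyIntegrable g volume ∧
    ∀ f : 𝓢(Euc d, ℂ), HasCompactSupport f → T f = ∫ x, f x * g x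

/-- A functional `N` on functions, such as a norm, evaluated at a tempered distribution: it is
`N g` if the distribution is given by the function `g` (which is unique up to null sets), and `∞`
if the distribution is not a function. -/
def distNorm {d : ℕ} (N : (Euc d → ℂ) → ℝ≥0∞) (T : 𝓢'(Euc d, ℂ)) : ℝ≥0∞ :=
  ⨅ (g : Euc d → ℂ) (_ : IsGivenBy T g), N g

/-- Extended seminorms on functions on `ℝ^d`. -/
structure IsFunNorm {d : ℕ} (N : (Euc d → ℂ) → ℝ≥0∞) : Prop where
  add_le : ∀ g h, AEStronglyMeasurable g volume → AEStronglyMeasurable h volume →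
    N (g + h) ≤ N g + N h
  smul_le : ∀ (c : ℂ) g, N (c • g) ≤ ‖c‖ₑ * N g

theorem IsGivenBy.add {d : ℕ} {S T : 𝓢'(Euc d, ℂ)} {g h : Euc d → ℂ}
    (hg : IsGivenBy S g) (hh : IsGivenBy T h) : IsGivenBy (S + T) (g + h) := by
  refine ⟨hg.1.add hh.1, fun f hf => ?_⟩
  have h1 : (S + T) f = S f + T f := rfl
  rw [h1, hg.2 f hf, hh.2 f hf, ← integral_add]
  · simp [mul_add]
  · exact hg.1.integrable_smul_left_of_hasCompactSupport f.continuous hf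
  · exact hh.1.integrable_smul_left_of_hasCompactSupport f.continuous hf

theorem IsGivenBy.smul {d : ℕ} {T : 𝓢'(Euc d, ℂ)} {g : Euc d → ℂ}
    (hg : IsGivenBy T g) (c : ℂ) : IsGivenBy (c • T) (c • g) := by
  refine ⟨hg.1.smul c, fun f hf => ?_⟩
  have h1 : (c • T) f = c • T f := rfl
  rw [h1, hg.2 f hf, ← integral_smul]
  congr 1
  ext x
  simp only [Pi.smul_apply, smul_eq_mul]
  ring

theorem isGivenBy_zero {d : ℕ} : IsGivenBy (0 : 𝓢'(Euc d, ℂ)) 0 :=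
  ⟨locallyIntegrable_zero, fun f _ => by
    have h1 : (0 : 𝓢'(Euc d, ℂ)) f = 0 := rfl
    simp [h1]⟩

/-- An extended seminorm on functions, evaluated at tempered distributions. -/
def distSeminorm {d : ℕ} (N : (Euc d → ℂ) → ℝ≥0∞) (hN : IsFunNorm N) :
    ExtSeminorm 𝓢'(Euc d, ℂ) where
  toFun := distNorm N
  add_le S T := by
    unfold distNorm
    simp only [ENNReal.iInf_add, ENNReal.add_iInf]
    refine le_iInf₂ fun g hg => le_iInf₂ fun h hh => ?_
    refine (iInf₂_le _ (IsGivenBy.add ?_ ?_)).trans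
      (hN.add_le _ _ ?_ ?_)
    all_goals first
      | assumption
      | exact hg.1.aestronglyMeasurable
      | exact hh.1.aestronglyMeasurable
  smul_le c T := by
    rcases eq_or_ne c 0 with rfl | hc
    · have h0 : N 0 = 0 := by simpa using hN.smul_le 0 0
      have hT : (0 : ℂ) • T = 0 := zero_smul ℂ T
      rw [hT]
      exact (iInf₂_le 0 isGivenBy_zero).trans (by simp [h0])
    · unfold distNorm
      have hc' : ‖c‖ₑ ≠ 0 := by simpa using hc
      simp only [ENNReal.mul_iInf_of_ne hc' enorm_ne_top]
      exact le_iInf₂ fun g hg => (iInf₂_le _ (hg.smul c)).trans (hN.smul_le c g)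

/-- The `L²` norm of a function. -/
def normL2 {d : ℕ} (g : Euc d → ℂ) : ℝ≥0∞ := eLpNorm g 2 volume

/-- `D_0` is the closed unit ball, and `D_j = {2^(j-1) < |x| ≤ 2^j}` for `j ≥ 1`. -/
def dyadicShell (d : ℕ) (j : ℕ) : Set (Euc d) :=
  if j = 0 then {x | ‖x‖ ≤ 1} else {x | (2 : ℝ) ^ (j - 1) < ‖x‖ ∧ ‖x‖ ≤ (2 : ℝ) ^ j}

/-- The norm `sup_j 2^(-j/2) ‖g‖_{L²(D_j)}`. -/
def normStar {d : ℕ} (g : Euc d → ℂ) : ℝ≥0∞ :=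
  ⨆ j : ℕ, ENNReal.ofReal ((2 : ℝ) ^ (-(j : ℝ) / 2)) *
    eLpNorm g 2 (volume.restrict (dyadicShell d j))

/-- The symbol `m_lam(ξ) = |lam - |ξ|²|`. -/
def symbM {d : ℕ} (lam : ℝ) (ξ : Euc d) : ℝ := |lam - ‖ξ‖ ^ 2|

/-- The norm `‖m_lam(2π ·)^(1/2) g‖_{L²}`. Here `2π ξ` appears because Mathlib's Fourier transform
has the phase `exp(-2πi x·ξ)`: if `v^(ξ) = (2π)^(-d/2) ∫ exp(-i x·ξ) v(x) dx` then the norm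
`‖m_lam^(1/2) v^‖_{L²}` is equal to `normM lam (𝓕 v)`, as `v^(ξ) = (2π)^(-d/2) 𝓕 v (ξ / 2π)`. -/
def normM {d : ℕ} (lam : ℝ) (g : Euc d → ℂ) : ℝ≥0∞ :=
  eLpNorm (fun ξ => (√(symbM lam ((2 * π) • ξ)) : ℂ) * g ξ) 2 volume

theorem isFunNorm_normL2 {d : ℕ} : IsFunNorm (normL2 (d := d)) where
  add_le g h hg hh := eLpNorm_add_le hg hh (by norm_num)
  smul_le c g := eLpNorm_const_smul_le

theorem isFunNorm_normStar {d : ℕ} : IsFunNorm (normStar (d := d)) where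
  add_le g h hg hh := by
    refine iSup_le fun j => ?_
    refine (mul_le_mul_right (eLpNorm_add_le hg.restrict hh.restrict (by norm_num)) _).trans ?_
    rw [mul_add]
    exact add_le_add (le_iSup (fun j : ℕ => ENNReal.ofReal ((2 : ℝ) ^ (-(j : ℝ) / 2)) *
      eLpNorm g 2 (volume.restrict (dyadicShell d j))) j)
      (le_iSup (fun j : ℕ => ENNReal.ofReal ((2 : ℝ) ^ (-(j : ℝ) / 2)) *
      eLpNorm h 2 (volume.restrict (dyadicShell d j))) j)
  smul_le c g := by
    refine iSup_le fun j => ?_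
    refine (mul_le_mul_right eLpNorm_const_smul_le _).trans ?_
    rw [mul_left_comm]
    gcongr
    exact le_iSup (fun j : ℕ => ENNReal.ofReal ((2 : ℝ) ^ (-(j : ℝ) / 2)) *
      eLpNorm g 2 (volume.restrict (dyadicShell d j))) j

theorem isFunNorm_normM {d : ℕ} (lam : ℝ) : IsFunNorm (normM (d := d) lam) where
  add_le g h hg hh := by
    have hm : AEStronglyMeasurable
        (fun ξ : Euc d => (√(symbM lam ((2 * π) • ξ)) : ℂ)) volume := by
      refine Continuous.aestronglyMeasurable ?_
      unfold symbM
      fun_prop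
    unfold normM
    refine le_trans (le_of_eq ?_) (eLpNorm_add_le (hm.mul hg) (hm.mul hh) (by norm_num))
    congr 1
    ext ξ
    simp [mul_add]
  smul_le c g := by
    unfold normM
    refine le_trans (le_of_eq ?_) eLpNorm_const_smul_le
    congr 1
    ext ξ
    simp only [Pi.smul_apply, smul_eq_mul]
    ring

/-! ### Littlewood–Paley projectors -/

/-- `ψ(ξ) = φ(ξ) - φ(2ξ)`. -/
def lpPsi {d : ℕ} (φ : 𝓢(Euc d, ℂ)) (ξ : Euc d) : ℂ := φ ξ - φ ((2 : ℝ) • ξ)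

/-- The projector `P_k`, with symbol `ψ(ξ / 2^k)` at the (angular) frequency `ξ`, which is
`2π ξ` in terms of the variable `ξ` of Mathlib's Fourier transform. -/
def lpProj {d : ℕ} (φ : 𝓢(Euc d, ℂ)) (k : ℤ) : 𝓢'(Euc d, ℂ) →L[ℂ] 𝓢'(Euc d, ℂ) :=
  TemperedDistribution.fourierMultiplierCLM ℂ
    (fun ξ => lpPsi φ ((2 * π / (2 : ℝ) ^ k) • ξ))

/-- The projector `P_{≤ k}`, with symbol `φ(ξ / 2^k)` at the angular frequency `ξ`. -/
def lpProjLe {d : ℕ} (φ : 𝓢(Euc d, ℂ)) (k : ℤ) : 𝓢'(Euc d, ℂ) →L[ℂ] 𝓢'(Euc d, ℂ) :=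
  TemperedDistribution.fourierMultiplierCLM ℂ
    (fun ξ => φ ((2 * π / (2 : ℝ) ^ k) • ξ))

/-- A dilate of a Schwartz function has temperate growth (so the multipliers above are the genuine
ones). -/
theorem hasTemperateGrowth_dilate {d : ℕ} (f : 𝓢(Euc d, ℂ)) (a : ℝ) :
    Function.HasTemperateGrowth (fun ξ : Euc d => f (a • ξ)) := by
  have h : Function.HasTemperateGrowth (fun ξ : Euc d => a • ξ) :=
    (a • ContinuousLinearMap.id ℝ (Euc d)).hasTemperateGrowth
  exact f.hasTemperateGrowth.comp h

/-- The integer `k_lam` with `2^(k_lam - 1) < lam^(1/2) ≤ 2^(k_lam)`. -/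
def critScale (lam : ℝ) : ℤ := Int.clog 2 (√lam)

theorem critScale_spec {lam : ℝ} (hlam : 0 < lam) :
    (2 : ℝ) ^ (critScale lam - 1) < √lam ∧ √lam ≤ (2 : ℝ) ^ critScale lam :=
  ⟨by simpa [critScale] using Int.zpow_pred_clog_lt_self one_lt_two (Real.sqrt_pos.2 hlam),
    by simpa [critScale] using Int.self_le_zpow_clog one_lt_two (√lam)⟩

/-! ### The space `Y_lam^*` -/

/-- The square of the norm of `Y_lam^*`. -/
def yStarSq {d : ℕ} (φ : 𝓢(Euc d, ℂ)) (lam : ℝ) (u : 𝓢'(Euc d, ℂ)) : ℝ≥0∞ :=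
  distNorm (normM lam) (𝓕 (lpProjLe φ (critScale lam - 3) u)) ^ (2 : ℝ)
    + ∑ k ∈ Finset.Icc (critScale lam - 2) (critScale lam + 1),
        ENNReal.ofReal (√lam) * distNorm normStar (lpProj φ k u) ^ (2 : ℝ)
    + ∑' k : Set.Ioi (critScale lam + 1),
        distNorm (normM lam) (𝓕 (lpProj φ k u)) ^ (2 : ℝ)

/-- Minkowski's inequality for series of extended nonnegative numbers. -/
theorem ell2_add_le {ι : Type*} (f g : ι → ℝ≥0∞) :
    (∑' i, (f i + g i) ^ (2 : ℝ)) ^ (1 / 2 : ℝ) ≤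
      (∑' i, f i ^ (2 : ℝ)) ^ (1 / 2 : ℝ) + (∑' i, g i ^ (2 : ℝ)) ^ (1 / 2 : ℝ) := by
  have h2 : (1 / 2 : ℝ) * 2 = 1 := by norm_num
  refine (ENNReal.rpow_le_rpow_iff (z := 2) (by norm_num)).1 ?_
  rw [← ENNReal.rpow_mul, h2, ENNReal.rpow_one, ENNReal.tsum_eq_iSup_sum]
  refine iSup_le fun s => ?_
  have hs := ENNReal.Lp_add_le s f g (p := 2) (by norm_num)
  calc ∑ i ∈ s, (f i + g i) ^ (2 : ℝ)
      = ((∑ i ∈ s, (f i + g i) ^ (2 : ℝ)) ^ (1 / 2 : ℝ)) ^ (2 : ℝ) := by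
        rw [← ENNReal.rpow_mul, h2, ENNReal.rpow_one]
    _ ≤ _ := by
        refine ENNReal.rpow_le_rpow (hs.trans ?_) (by norm_num)
        gcongr
        · exact ENNReal.sum_le_tsum s
        · exact ENNReal.sum_le_tsum s

/-- The square root of a sum of squares of extended seminorms is an extended seminorm. -/
def ExtSeminorm.ell2 {V : Type*} [AddCommGroup V] [Module ℂ V] {ι : Type*}
    (p : ι → ExtSeminorm V) : ExtSeminorm V where
  toFun u := (∑' i, (p i).toFun u ^ (2 : ℝ)) ^ (1 / 2 : ℝ)
  add_le u v := by
    refine le_trans ?_ (ell2_add_le _ _)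
    gcongr
    exact (p _).add_le u v
  smul_le c u := by
    have h2 : (2 : ℝ) * (1 / 2) = 1 := by norm_num
    simp only [ExtSeminorm.smul_eq]
    simp only [ENNReal.mul_rpow_of_nonneg _ _ (zero_le_two (α := ℝ)), ENNReal.tsum_mul_left]
    rw [ENNReal.mul_rpow_of_nonneg _ _ (by norm_num), ← ENNReal.rpow_mul, h2, ENNReal.rpow_one]

/-- The pullback of an extended seminorm under a linear map. -/
def ExtSeminorm.comap {V W : Type*} [AddCommGroup V] [Module ℂ V] [AddCommGroup W] [Module ℂ W]
    (p : ExtSeminorm W) (A : V →ₗ[ℂ] W) : ExtSeminorm V where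
  toFun u := p.toFun (A u)
  add_le u v := by rw [_root_.map_add]; exact p.add_le _ _
  smul_le c u := by rw [_root_.map_smul]; exact p.smul_le _ _

/-- A multiple of an extended seminorm. -/
def ExtSeminorm.scale {V : Type*} [AddCommGroup V] [Module ℂ V]
    (p : ExtSeminorm V) (a : ℝ≥0∞) : ExtSeminorm V where
  toFun u := a * p.toFun u
  add_le u v := by rw [← mul_add]; gcongr; exact p.add_le _ _
  smul_le c u := by rw [mul_left_comm]; gcongr; exact p.smul_le _ _

/-- The pieces whose squares add up to the square of the norm of `Y_lam^*`. -/
def yStarPiece {d : ℕ} (φ : 𝓢(Euc d, ℂ)) (lam : ℝ) :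
    (Unit ⊕ Finset.Icc (critScale lam - 2) (critScale lam + 1)) ⊕ Set.Ioi (critScale lam + 1) →
      ExtSeminorm 𝓢'(Euc d, ℂ)
  | .inl (.inl _) => (distSeminorm (normM lam) (isFunNorm_normM lam)).comap
      ((fourierCLM ℂ 𝓢'(Euc d, ℂ)).toLinearMap ∘ₗ (lpProjLe φ (critScale lam - 3)).toLinearMap)
  | .inl (.inr k) => ((distSeminorm normStar isFunNorm_normStar).comap
      (lpProj φ k).toLinearMap).scale (ENNReal.ofReal (√lam) ^ (1 / 2 : ℝ))
  | .inr k => (distSeminorm (normM lam) (isFunNorm_normM lam)).comap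
      ((fourierCLM ℂ 𝓢'(Euc d, ℂ)).toLinearMap ∘ₗ (lpProj φ k).toLinearMap)

theorem yStarSq_eq {d : ℕ} (φ : 𝓢(Euc d, ℂ)) (lam : ℝ) (u : 𝓢'(Euc d, ℂ)) :
    (ExtSeminorm.ell2 (yStarPiece φ lam)).toFun u = yStarSq φ lam u ^ (1 / 2 : ℝ) := by
  have h2 : (1 / 2 : ℝ) * 2 = 1 := by norm_num
  have hr : ∀ a b : ℝ≥0∞, (a ^ (1 / 2 : ℝ) * b) ^ (2 : ℝ) = a * b ^ (2 : ℝ) := fun a b => by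
    rw [ENNReal.mul_rpow_of_nonneg _ _ zero_le_two, ← ENNReal.rpow_mul, h2, ENNReal.rpow_one]
  unfold ExtSeminorm.ell2 yStarSq
  dsimp only
  have hs : ∀ {α β : Type} (f : α ⊕ β → ℝ≥0∞),
      ∑' i, f i = ∑' i, f (.inl i) + ∑' i, f (.inr i) := fun f =>
    Summable.tsum_sum ENNReal.summable ENNReal.summable
  rw [hs, hs]
  congr 3
  · simp [yStarPiece, ExtSeminorm.comap, distSeminorm]
  · refine (Finset.tsum_subtype (Finset.Icc (critScale lam - 2) (critScale lam + 1))
      (fun k => (((distSeminorm normStar isFunNorm_normStar).comap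
        (lpProj φ k).toLinearMap).scale (ENNReal.ofReal (√lam) ^ (1 / 2 : ℝ))).toFun u ^ (2 : ℝ))).trans ?_
    exact Finset.sum_congr rfl fun k _ => hr _ _

/-- The norm of `Y_lam^*`, as an extended seminorm on tempered distributions. -/
def yStarSeminorm {d : ℕ} (φ : 𝓢(Euc d, ℂ)) (lam : ℝ) : ExtSeminorm 𝓢'(Euc d, ℂ) where
  toFun u := yStarSq φ lam u ^ (1 / 2 : ℝ)
  add_le u v := by
    simp only [← yStarSq_eq]; exact (ExtSeminorm.ell2 (yStarPiece φ lam)).add_le u v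
  smul_le c u := by
    simp only [← yStarSq_eq]; exact (ExtSeminorm.ell2 (yStarPiece φ lam)).smul_le c u

/-- The space `Y_lam^*` of the tempered distributions with finite `Y_lam^*` norm. -/
abbrev YStar {d : ℕ} (φ : 𝓢(Euc d, ℂ)) (lam : ℝ) : Type := (yStarSeminorm φ lam).Space

/-! ### The homogeneous Besov space -/

/-- The seminorm `∑_l 2^(l/2) ‖P_l f‖_{L²}`, as an extended seminorm on tempered distributions. -/
def besovSeminorm {d : ℕ} (φ : 𝓢(Euc d, ℂ)) : ExtSeminorm 𝓢'(Euc d, ℂ) where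
  toFun f := ∑' l : ℤ, ENNReal.ofReal ((2 : ℝ) ^ ((l : ℝ) / 2)) * distNorm normL2 (lpProj φ l f)
  add_le f g := by
    rw [← ENNReal.tsum_add]
    refine ENNReal.tsum_le_tsum fun l => ?_
    rw [← mul_add, _root_.map_add]
    gcongr
    exact (distSeminorm normL2 isFunNorm_normL2).add_le _ _
  smul_le c f := by
    rw [← ENNReal.tsum_mul_left]
    refine ENNReal.tsum_le_tsum fun l => ?_
    rw [mul_left_comm, _root_.map_smul]
    gcongr
    exact (distSeminorm normL2 isFunNorm_normL2).smul_le _ _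

/-- The homogeneous Besov space of regularity `1/2`, integrability `2` and summability `1`: the
tempered distributions with finite Besov seminorm, with the topology of that seminorm. -/
abbrev HomBesov {d : ℕ} (φ : 𝓢(Euc d, ℂ)) : Type := (besovSeminorm φ).Space

/-! ### The cutoff -/

/-- `χ(x) = (2π)^(-d/2) ∫ exp(i (a x)·ξ) θ(ξ) dξ`. -/
def bandCutoff {d : ℕ} (θ : 𝓢(Euc d, ℝ)) (a : ℝ) (x : Euc d) : ℂ :=
  ((2 * π) ^ (-(d : ℝ) / 2) : ℝ) *
    ∫ ξ, Complex.exp (Complex.I * ((a * inner ℝ x ξ : ℝ) : ℂ)) * (θ ξ : ℂ)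

/-- The cutoff is a dilate of a Schwartz function. In particular it has temperate growth, so that
its product with a tempered distribution is the usual one. -/
theorem hasTemperateGrowth_bandCutoff {d : ℕ} (θ : 𝓢(Euc d, ℝ)) (a : ℝ) :
    Function.HasTemperateGrowth (bandCutoff θ a) := by
  let θ' : 𝓢(Euc d, ℂ) := SchwartzMap.postcompCLM Complex.ofRealCLM θ
  have h := (Function.HasTemperateGrowth.const
    (((2 * π) ^ (-(d : ℝ) / 2) : ℝ) : ℂ)).mul (hasTemperateGrowth_dilate (𝓕⁻ θ') (a / (2 * π)))
  refine Eq.subst (motive := Function.HasTemperateGrowth) (funext fun x => ?_) h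
  have hx : 𝓕⁻ θ' ((a / (2 * π)) • x) =
      ∫ ξ, Complex.exp (Complex.I * ((a * inner ℝ x ξ : ℝ) : ℂ)) * (θ ξ : ℂ) := by
    rw [SchwartzMap.fourierInv_coe, Real.fourierInv_eq']
    congr 1
    ext ξ
    have : θ' ξ = (θ ξ : ℂ) := rfl
    rw [this, smul_eq_mul, inner_smul_right, real_inner_comm]
    congr 2
    have hpi : (π : ℂ) ≠ 0 := by exact_mod_cast Real.pi_ne_zero
    push_cast
    field_simp
  simp only [Pi.mul_apply, hx]
  rfl

end

noncomputable section

open Filter Topology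
open scoped ContDiff Pointwise

/-! ### Density of compactly supported Schwartz functions -/

/-! The cutoff is band limited: `χ = 𝓕⁻ κ` with `κ` smooth of compact support. So the Fourier
transform of `χ u` is the function `G(ξ) = û(κ(ξ - ·))` (`bandFourier`), and everything rests on
bounds for `G` that are linear in the norm of `u`.

Away from the critical sphere `|ξ|² = λ` the weight `m_λ` is comparable to `(1 + |ξ|)²`, since `λ >
1`. The low and high frequency pieces of `û` are therefore functions with a common majorant `H` such
that `(1 + |ξ|) H` is in `L²` (`exists_majorant`). The four pieces near the sphere are controlled
only in physical space: they become square integrable after division by `1 + |x|²`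
(`eLpNorm_quadWeight_inv_mul_le`). Together, `|û(f)|` is at most `∫ |f| H` plus a multiple of `‖(1 +
|x|²) 𝓕 f‖_{L²}` (`exists_enorm_fourier_apply_le`).

For `f = κ(ξ - ·)` the function `𝓕 f` is `𝓕⁻ κ` times a character, and this makes `G` bounded and
Lipschitz, with constants proportional to the norm of `u` (`exists_bandFourier_bounds`). For `ξ`
outside a fixed ball, `κ(ξ - ·)` does not meet the critical frequencies, so `G` is dominated by `|κ|
* H`; Young's inequality then puts `(1 + |ξ|) G` in `L²` (`exists_lintegral_bandFourier_le`). Thus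
`χ u` has one derivative in `L²`, whereas the Besov norm asks for half a derivative.

The gap is spent in two halves, through the Sobolev space of order `3/4`. Between orders `1` and
`3/4`, the tails of `G` are uniformly small, which with the Lipschitz bound gives compactness by
finite rank approximation (`isCompactOperator_of_tail`). Between orders `3/4` and `1/2`, the
Littlewood–Paley pieces are summable with geometric factors `2^(-|l|/4)`
(`besovSeminorm_sobFourierInv_le`). A compact operator followed by a bounded one is compact.

That `G` really represents `𝓕 (χ u)` is an interchange of `û` with an integral, checked piece by
piece (`bandFubini_fourier`). -/

theorem norm_iteratedFDeriv_dilate_sub_one_le {d : ℕ} (φ : 𝓢(Euc d, ℂ)) (i : ℕ) {c : ℝ}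
    (hc : |c| ≤ 1) (x : Euc d) :
    ‖iteratedFDeriv ℝ i (fun x : Euc d => φ (c • x) - 1) x‖ ≤ SchwartzMap.seminorm ℝ 0 i φ + 1 := by
  have h1 : ContDiff ℝ ∞ (fun x : Euc d => φ (c • x)) := (φ.smooth ⊤).comp (by fun_prop)
  have h2 : iteratedFDeriv ℝ i (fun x : Euc d => φ (c • x) - 1) x =
      iteratedFDeriv ℝ i (fun x : Euc d => φ (c • x)) x -
        iteratedFDeriv ℝ i (fun _ : Euc d => (1 : ℂ)) x :=
    iteratedFDeriv_sub_apply (h1.contDiffAt.of_le (mod_cast le_top)) contDiffAt_const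
  rw [h2]
  refine (norm_sub_le _ _).trans (add_le_add ?_ ?_)
  · rw [iteratedFDeriv_comp_const_smul c (φ.smooth i), norm_smul, norm_pow]
    refine le_trans ?_ (φ.norm_iteratedFDeriv_le_seminorm ℝ i (c • x))
    exact mul_le_of_le_one_left (norm_nonneg _) (pow_le_one₀ (norm_nonneg _) hc)
  · rcases Nat.eq_zero_or_pos i with rfl | hi
    · simp
    · rw [iteratedFDeriv_const_of_ne hi.ne']
      simp

/-- The error `(φ(c x) - 1) f` vanishes for `|x| < 1/c`. Elsewhere `1 ≤ c |x|`, so one more power of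
`|x|` in the seminorm of `f` buys a factor `c`. -/
theorem tendsto_smulLeftCLM_dilate {d : ℕ} (φ : 𝓢(Euc d, ℂ))
    (hφ : ∀ ξ : Euc d, ‖ξ‖ ≤ 1 → φ ξ = 1) (f : 𝓢(Euc d, ℂ)) :
    Tendsto (fun n : ℕ => SchwartzMap.smulLeftCLM ℂ (fun x => φ ((1 / (n + 1 : ℝ)) • x)) f)
      atTop (𝓝 f) := by
  rw [(schwartz_withSeminorms ℝ (Euc d) ℂ).tendsto_nhds]
  rintro ⟨k, j⟩ ε hε
  set C : ℝ := ∑ i ∈ Finset.range (j + 1), (j.choose i : ℝ) *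
    (SchwartzMap.seminorm ℝ 0 i φ + 1) * SchwartzMap.seminorm ℝ (k + 1) (j - i) f with hC
  have hC0 : 0 ≤ C := Finset.sum_nonneg fun i _ => by positivity
  have hlim : Tendsto (fun n : ℕ => C * (1 / ((n : ℝ) + 1))) atTop (𝓝 0) := by
    simpa using tendsto_one_div_add_atTop_nhds_zero_nat.const_mul C
  filter_upwards [hlim.eventually_lt_const hε] with n hn
  refine lt_of_le_of_lt ?_ hn
  have hn0 : (0 : ℝ) < (n : ℝ) + 1 := by positivity
  set c : ℝ := 1 / (n + 1 : ℝ) with hc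
  have hc1 : |c| ≤ 1 := by
    rw [abs_of_pos (by positivity), hc, div_le_one hn0]
    linarith [n.cast_nonneg (α := ℝ)]
  refine SchwartzMap.seminorm_le_bound ℝ k j _ (by positivity) fun x => ?_
  have hfun : ((SchwartzMap.smulLeftCLM ℂ (fun x => φ (c • x)) f - f : 𝓢(Euc d, ℂ)) : Euc d → ℂ) =
      fun x => (φ (c • x) - 1) * f x := by
    ext y
    rw [sub_apply, SchwartzMap.smulLeftCLM_apply_apply (hasTemperateGrowth_dilate φ c)]
    simp [sub_mul]
  rw [hfun]
  have hsm : ContDiff ℝ ∞ (fun x : Euc d => φ (c • x) - 1) :=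
    ((φ.smooth ⊤).comp (by fun_prop)).sub contDiff_const
  rcases lt_or_ge ‖x‖ (n + 1) with hx | hx
  · have h0 : (fun x => (φ (c • x) - 1) * f x) =ᶠ[𝓝 x] fun _ => 0 := by
      filter_upwards [continuous_norm.continuousAt.eventually_lt continuousAt_const hx] with y hy
      rw [hφ, sub_self, zero_mul]
      rw [norm_smul, Real.norm_eq_abs, abs_of_pos (by positivity), hc, one_div,
        inv_mul_le_one₀ hn0]
      exact hy.le
    rw [(Filter.EventuallyEq.iteratedFDeriv ℝ h0 j).eq_of_nhds]
    simp only [iteratedFDeriv_fun_zero, Pi.zero_apply, norm_zero, mul_zero]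
    positivity
  · have hx0 : 0 < ‖x‖ := hn0.trans_le hx
    have h1 := norm_iteratedFDeriv_mul_le (n := j) (N := ∞) hsm (f.smooth ⊤) x (mod_cast le_top)
    calc _ ≤ ‖x‖ ^ k * _ := mul_le_mul_of_nonneg_left h1 (by positivity)
      _ ≤ C * c := by
        rw [Finset.mul_sum, hC, Finset.sum_mul]
        refine Finset.sum_le_sum fun i _ => ?_
        have h2 := norm_iteratedFDeriv_dilate_sub_one_le φ i hc1 x
        have h3 : ‖x‖ ^ k * ‖iteratedFDeriv ℝ (j - i) f x‖ ≤
            SchwartzMap.seminorm ℝ (k + 1) (j - i) f * c := by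
          have h4 := f.le_seminorm ℝ (k + 1) (j - i) x
          have h5 : (1 : ℝ) ≤ ‖x‖ * c := by
            rw [hc, mul_one_div, le_div_iff₀ hn0]; linarith
          calc _ ≤ (‖x‖ ^ k * ‖iteratedFDeriv ℝ (j - i) f x‖) * (‖x‖ * c) :=
                le_mul_of_one_le_right (by positivity) h5
            _ = ‖x‖ ^ (k + 1) * ‖iteratedFDeriv ℝ (j - i) f x‖ * c := by ring
            _ ≤ _ := by gcongr
        calc _ = (j.choose i : ℝ) * ‖iteratedFDeriv ℝ i (fun x : Euc d => φ (c • x) - 1) x‖ *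
              (‖x‖ ^ k * ‖iteratedFDeriv ℝ (j - i) f x‖) := by ring
          _ ≤ (j.choose i : ℝ) * (SchwartzMap.seminorm ℝ 0 i φ + 1) *
              (SchwartzMap.seminorm ℝ (k + 1) (j - i) f * c) := by gcongr
          _ = _ := by ring

theorem exists_schwartz_cutoff (d : ℕ) : ∃ φ : 𝓢(Euc d, ℂ), HasCompactSupport φ ∧
    ∀ ξ : Euc d, ‖ξ‖ ≤ 1 → φ ξ = 1 := by
  let b : ContDiffBump (0 : Euc d) := ⟨1, 2, one_pos, one_lt_two⟩
  have hb : HasCompactSupport (Complex.ofRealCLM ∘ b) := b.hasCompactSupport.comp_left rfl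
  have hs : ContDiff ℝ ∞ (Complex.ofRealCLM ∘ b) := Complex.ofRealCLM.contDiff.comp b.contDiff
  refine ⟨hb.toSchwartzMap hs, hb, fun ξ hξ => ?_⟩
  have : b ξ = 1 := b.one_of_mem_closedBall (by simpa using hξ)
  simp [this]

theorem hasCompactSupport_dilate {d : ℕ} {φ : 𝓢(Euc d, ℂ)} (hφ : HasCompactSupport φ) {c : ℝ}
    (hc : c ≠ 0) : HasCompactSupport (fun x : Euc d => φ (c • x)) :=
  hφ.comp_homeomorph (Homeomorph.smulOfNeZero c hc)

theorem hasCompactSupport_smulLeftCLM {d : ℕ} {g : Euc d → ℂ} (hg : HasCompactSupport g)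
    (f : 𝓢(Euc d, ℂ)) : HasCompactSupport (SchwartzMap.smulLeftCLM ℂ g f) :=
  hg.of_isClosed_subset (isClosed_tsupport _)
    ((SchwartzMap.tsupport_smulLeftCLM_subset g f).trans Set.inter_subset_right)

/-- `IsGivenBy` tests only against compactly supported functions; by density and continuity this
determines the distribution. -/
theorem TemperedDistribution.ext_of_hasCompactSupport {d : ℕ} {S T : 𝓢'(Euc d, ℂ)}
    (h : ∀ f : 𝓢(Euc d, ℂ), HasCompactSupport f → S f = T f) : S = T := by
  obtain ⟨φ, hφ, hφ1⟩ := exists_schwartz_cutoff d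
  ext f
  have hlim := tendsto_smulLeftCLM_dilate φ hφ1 f
  refine tendsto_nhds_unique ((S.continuous.tendsto f).comp hlim) ?_
  refine ((T.continuous.tendsto f).comp hlim).congr fun n => ?_
  exact (h _ (hasCompactSupport_smulLeftCLM (hasCompactSupport_dilate hφ (by positivity)) f)).symm

/-! ### Functions defining a distribution -/

theorem IsGivenBy.ae_eq {d : ℕ} {T : 𝓢'(Euc d, ℂ)} {g h : Euc d → ℂ}
    (hg : IsGivenBy T g) (hh : IsGivenBy T h) : g =ᵐ[volume] h := by
  refine ae_eq_of_integral_contDiff_smul_eq hg.1 hh.1 fun p hp hpc => ?_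
  have h1 : HasCompactSupport (Complex.ofRealCLM ∘ p) := hpc.comp_left rfl
  have h2 : ContDiff ℝ ∞ (Complex.ofRealCLM ∘ p) := Complex.ofRealCLM.contDiff.comp hp
  have := (hg.2 (h1.toSchwartzMap h2) h1).symm.trans (hh.2 (h1.toSchwartzMap h2) h1)
  simpa using this

/-- Transfers support information from a distribution to the function that represents it. -/
theorem IsGivenBy.ae_eq_zero_of_isOpen {d : ℕ} {T : 𝓢'(Euc d, ℂ)} {g : Euc d → ℂ}
    (hg : IsGivenBy T g) {U : Set (Euc d)} (hU : IsOpen U)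
    (hT : ∀ f : 𝓢(Euc d, ℂ), HasCompactSupport f → tsupport f ⊆ U → T f = 0) :
    ∀ᵐ x, x ∈ U → g x = 0 := by
  refine hU.ae_eq_zero_of_integral_contDiff_smul_eq_zero (hg.1.locallyIntegrableOn U)
    fun p hp hpc hpU => ?_
  have h1 : HasCompactSupport (Complex.ofRealCLM ∘ p) := hpc.comp_left rfl
  have h2 : ContDiff ℝ ∞ (Complex.ofRealCLM ∘ p) := Complex.ofRealCLM.contDiff.comp hp
  have h3 : tsupport (Complex.ofRealCLM ∘ p) ⊆ U :=
    (closure_mono (Function.support_comp_subset rfl p)).trans hpU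
  have := (hg.2 (h1.toSchwartzMap h2) h1).symm.trans (hT (h1.toSchwartzMap h2) h1 h3)
  simpa using this

theorem IsGivenBy.congr_ae {d : ℕ} {T : 𝓢'(Euc d, ℂ)} {g h : Euc d → ℂ}
    (hg : IsGivenBy T g) (hgh : g =ᵐ[volume] h) : IsGivenBy T h :=
  ⟨hg.1.congr hgh, fun f hf => (hg.2 f hf).trans
    (integral_congr_ae (by filter_upwards [hgh] with x hx; rw [hx]))⟩

/-- A functional on functions that does not see null sets. -/
def AEInvariant {d : ℕ} (N : (Euc d → ℂ) → ℝ≥0∞) : Prop :=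
  ∀ g h : Euc d → ℂ, g =ᵐ[volume] h → N g = N h

/-- The infimum that defines `distNorm` runs over a single class of functions modulo null sets. -/
theorem distNorm_eq {d : ℕ} {N : (Euc d → ℂ) → ℝ≥0∞} (hN : AEInvariant N) {T : 𝓢'(Euc d, ℂ)}
    {g : Euc d → ℂ} (hg : IsGivenBy T g) : distNorm N T = N g :=
  le_antisymm (iInf₂_le g hg) (le_iInf₂ fun _ hh => (hN _ _ (hg.ae_eq hh)).le)

theorem exists_isGivenBy_of_distNorm_lt_top {d : ℕ} {N : (Euc d → ℂ) → ℝ≥0∞}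
    (hN : AEInvariant N) {T : 𝓢'(Euc d, ℂ)} (hT : distNorm N T < ⊤) :
    ∃ g, IsGivenBy T g ∧ N g = distNorm N T := by
  obtain ⟨g, hg⟩ := iInf_lt_iff.1 hT
  obtain ⟨hg, -⟩ := iInf_lt_iff.1 hg
  exact ⟨g, hg, (distNorm_eq hN hg).symm⟩

theorem aeInvariant_normL2 {d : ℕ} : AEInvariant (normL2 (d := d)) :=
  fun _ _ h => eLpNorm_congr_ae h

theorem aeInvariant_normStar {d : ℕ} : AEInvariant (normStar (d := d)) := fun g h hgh => by
  unfold normStar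
  congr! 3 with j
  exact eLpNorm_congr_ae (ae_restrict_of_ae hgh)

theorem aeInvariant_normM {d : ℕ} (lam : ℝ) : AEInvariant (normM (d := d) lam) :=
  fun g h hgh => eLpNorm_congr_ae (by filter_upwards [hgh] with x hx; rw [hx])

/-! ### `L²` norms and the Cauchy–Schwarz inequality -/

theorem eLpNorm_two_sq {α F : Type*} [MeasurableSpace α] [NormedAddCommGroup F] (f : α → F)
    (μ : Measure α) : eLpNorm f 2 μ ^ 2 = ∫⁻ x, ‖f x‖ₑ ^ 2 ∂μ := by
  have h := eLpNorm_nnreal_pow_eq_lintegral (f := f) (μ := μ) (p := 2) two_ne_zero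
  simpa using h

theorem lintegral_mul_sq_le {α : Type*} [MeasurableSpace α] (μ : Measure α) {f g : α → ℝ≥0∞}
    (hf : AEMeasurable f μ) (hg : AEMeasurable g μ) :
    (∫⁻ x, f x * g x ∂μ) ^ 2 ≤ (∫⁻ x, f x ^ 2 ∂μ) * ∫⁻ x, g x ^ 2 ∂μ := by
  have h := ENNReal.lintegral_mul_le_Lp_mul_Lq μ (Real.HolderConjugate.two_two) hf hg
  have h2 : ∀ a : ℝ≥0∞, (a ^ (1 / 2 : ℝ)) ^ 2 = a := fun a => by
    rw [← ENNReal.rpow_natCast, ← ENNReal.rpow_mul]; norm_num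
  calc _ ≤ _ := pow_le_pow_left' h 2
    _ = _ := by rw [mul_pow, h2, h2]; simp

theorem ENNReal.le_mul_of_sq_le_sq_mul_sq {a b c : ℝ≥0∞} (h : a ^ 2 ≤ b ^ 2 * c ^ 2) :
    a ≤ b * c := by
  rw [← mul_pow] at h
  exact (ENNReal.pow_le_pow_left_iff two_ne_zero).1 h

theorem enorm_integral_mul_le {α : Type*} [MeasurableSpace α] {μ : Measure α} {f g : α → ℂ}
    (hf : AEStronglyMeasurable f μ) (hg : AEStronglyMeasurable g μ) :
    ‖∫ x, f x * g x ∂μ‖ₑ ≤ eLpNorm f 2 μ * eLpNorm g 2 μ := by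
  refine (enorm_integral_le_lintegral_enorm _).trans ?_
  simp only [enorm_mul]
  refine ENNReal.le_mul_of_sq_le_sq_mul_sq ?_
  rw [eLpNorm_two_sq, eLpNorm_two_sq]
  exact lintegral_mul_sq_le μ hf.enorm hg.enorm

/-! ### Functions of polynomial growth in the mean -/

/-- The weight `1 + |x|²`. -/
def quadWeight {d : ℕ} (x : Euc d) : ℝ := 1 + ‖x‖ ^ 2

theorem quadWeight_pos {d : ℕ} (x : Euc d) : 0 < quadWeight x := by unfold quadWeight; positivity

theorem continuous_quadWeight {d : ℕ} : Continuous (quadWeight (d := d)) := by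
  unfold quadWeight; fun_prop

theorem hasTemperateGrowth_quadWeight {d : ℕ} :
    Function.HasTemperateGrowth (fun x : Euc d => (quadWeight x : ℂ)) := by
  have h1 : Function.HasTemperateGrowth (quadWeight (d := d)) :=
    (Function.HasTemperateGrowth.const (1 : ℝ)).add (Function.hasTemperateGrowth_norm_sq (Euc d))
  exact Function.Complex.hasTemperateGrowth_ofReal.comp h1

theorem memLp_quadWeight_mul {d : ℕ} (f : 𝓢(Euc d, ℂ)) :
    MemLp (fun x => (quadWeight x : ℂ) * f x) 2 volume := by
  have h := (SchwartzMap.smulLeftCLM ℂ (fun x : Euc d => (quadWeight x : ℂ)) f).memLp 2 volume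
  refine (memLp_congr_ae (Eventually.of_forall fun x => ?_)).1 h
  rw [SchwartzMap.smulLeftCLM_apply_apply hasTemperateGrowth_quadWeight, smul_eq_mul]

/-- Needed because the pieces near the critical sphere are tested against `𝓕 f`, which need not have
compact support. The function `g / (1 + |x|²)` is in `L²` and defines a tempered distribution;
multiplied by `1 + |x|²`, it agrees with `T` on compactly supported functions, hence everywhere. -/
theorem IsGivenBy.apply_of_memLp {d : ℕ} {T : 𝓢'(Euc d, ℂ)} {g : Euc d → ℂ}
    (hT : IsGivenBy T g) (hg : MemLp (fun x => (quadWeight x : ℂ)⁻¹ * g x) 2 volume)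
    (f : 𝓢(Euc d, ℂ)) : T f = ∫ x, f x * g x := by
  have key : ∀ p : 𝓢(Euc d, ℂ), TemperedDistribution.smulLeftCLM ℂ
      (fun x : Euc d => (quadWeight x : ℂ)) (Lp.toTemperedDistribution (hg.toLp _)) p =
        ∫ x, p x * g x := fun p => by
    rw [TemperedDistribution.smulLeftCLM_apply_apply, Lp.toTemperedDistribution_apply]
    refine integral_congr_ae ?_
    filter_upwards [hg.coeFn_toLp] with x hx
    have : (quadWeight x : ℂ) ≠ 0 := by exact_mod_cast (quadWeight_pos x).ne'
    rw [hx, SchwartzMap.smulLeftCLM_apply_apply hasTemperateGrowth_quadWeight, smul_eq_mul,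
      smul_eq_mul]
    field_simp
  rw [← key f]
  congr 1
  exact TemperedDistribution.ext_of_hasCompactSupport fun p hp => by rw [key, hT.2 p hp]

theorem enorm_integral_mul_le_quadWeight {d : ℕ} (f : 𝓢(Euc d, ℂ)) {g : Euc d → ℂ}
    (hg : AEStronglyMeasurable g volume) :
    ‖∫ x, f x * g x‖ₑ ≤ eLpNorm (fun x => (quadWeight x : ℂ)⁻¹ * g x) 2 volume *
      eLpNorm (fun x => (quadWeight x : ℂ) * f x) 2 volume := by
  have h1 : AEStronglyMeasurable (fun x : Euc d => (quadWeight x : ℂ)) volume :=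
    (Complex.continuous_ofReal.comp continuous_quadWeight).aestronglyMeasurable
  have h2 : AEStronglyMeasurable (fun x : Euc d => (quadWeight x : ℂ)⁻¹ * g x) volume :=
    (h1.aemeasurable.inv.aestronglyMeasurable).mul hg
  refine le_trans (le_of_eq ?_) (enorm_integral_mul_le h2 (h1.mul f.continuous.aestronglyMeasurable))
  congr 2
  ext x
  have : (quadWeight x : ℂ) ≠ 0 := by exact_mod_cast (quadWeight_pos x).ne'
  field_simp

theorem iUnion_dyadicShell (d : ℕ) : ⋃ j, dyadicShell d j = Set.univ := by
  refine Set.eq_univ_of_forall fun x => Set.mem_iUnion.2 ?_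
  have hex : ∃ j : ℕ, ‖x‖ ≤ (2 : ℝ) ^ j := by
    obtain ⟨j, hj⟩ := pow_unbounded_of_one_lt ‖x‖ one_lt_two
    exact ⟨j, hj.le⟩
  classical
  refine ⟨Nat.find hex, ?_⟩
  unfold dyadicShell
  split_ifs with h
  · have := Nat.find_spec hex
    rw [h] at this
    simpa using this
  · refine ⟨?_, Nat.find_spec hex⟩
    have := Nat.find_min hex (Nat.sub_lt (Nat.pos_of_ne_zero h) one_pos)
    exact not_le.1 this

theorem measurableSet_dyadicShell (d j : ℕ) : MeasurableSet (dyadicShell d j) := by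
  unfold dyadicShell
  split_ifs
  · exact measurableSet_le measurable_norm measurable_const
  · exact (measurableSet_lt measurable_const measurable_norm).inter
      (measurableSet_le measurable_norm measurable_const)

theorem pow_le_quadWeight {d j : ℕ} {x : Euc d} (hx : x ∈ dyadicShell d j) :
    (2 : ℝ) ^ j ≤ 2 * quadWeight x := by
  unfold dyadicShell at hx
  unfold quadWeight
  split_ifs at hx with h
  · subst h; nlinarith [norm_nonneg x]
  · obtain ⟨i, rfl⟩ := Nat.exists_eq_succ_of_ne_zero h
    have h1 : (2 : ℝ) ^ i < ‖x‖ := by simpa using hx.1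
    rw [pow_succ]
    nlinarith [norm_nonneg x, sq_nonneg (‖x‖ - 1)]

/-- On `D_j` the squared inverse weight is at most `4 · 2^(-2j)`, while the squared `L²` norm of `g`
there is at most `2^j` times that of `normStar`. The shells thus contribute `4 · 2^(-j)`, with sum
`8 ≤ 4²`. -/
theorem eLpNorm_quadWeight_inv_mul_le {d : ℕ} (g : Euc d → ℂ) :
    eLpNorm (fun x => (quadWeight x : ℂ)⁻¹ * g x) 2 volume ≤ 4 * normStar g := by
  have hj : ∀ j : ℕ, ∫⁻ x in dyadicShell d j, ‖(quadWeight x : ℂ)⁻¹ * g x‖ₑ ^ 2 ≤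
      4 * normStar g ^ 2 * (2⁻¹ : ℝ≥0∞) ^ j := fun j => by
    have h1 : ∀ x ∈ dyadicShell d j, ‖(quadWeight x : ℂ)⁻¹ * g x‖ₑ ^ 2 ≤
        4 * (2⁻¹ : ℝ≥0∞) ^ (2 * j) * ‖g x‖ₑ ^ 2 := fun x hx => by
      have h2 := pow_le_quadWeight hx
      have h3 : ‖(quadWeight x : ℂ)⁻¹‖ₑ ≤ 2 * (2⁻¹ : ℝ≥0∞) ^ j := by
        have h4 : ‖(quadWeight x : ℂ)⁻¹‖ ≤ 2 * (2⁻¹ : ℝ) ^ j := by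
          rw [norm_inv, Complex.norm_real, Real.norm_eq_abs, abs_of_pos (quadWeight_pos x),
            inv_pow, ← div_eq_mul_inv, inv_eq_one_div,
            div_le_div_iff₀ (quadWeight_pos x) (by positivity)]
          linarith
        rw [← ofReal_norm]
        refine (ENNReal.ofReal_le_ofReal h4).trans (le_of_eq ?_)
        rw [ENNReal.ofReal_mul (by norm_num), ENNReal.ofReal_pow (by norm_num),
          ENNReal.ofReal_inv_of_pos (by norm_num)]
        norm_num
      rw [enorm_mul, mul_pow]
      gcongr
      calc _ ≤ (2 * (2⁻¹ : ℝ≥0∞) ^ j) ^ 2 := by gcongr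
        _ = _ := by rw [mul_pow, ← pow_mul, mul_comm j 2]; norm_num
    calc _ ≤ ∫⁻ x in dyadicShell d j, 4 * (2⁻¹ : ℝ≥0∞) ^ (2 * j) * ‖g x‖ₑ ^ 2 :=
          setLIntegral_mono' (measurableSet_dyadicShell d j) h1
      _ = 4 * (2⁻¹ : ℝ≥0∞) ^ (2 * j) * eLpNorm g 2 (volume.restrict (dyadicShell d j)) ^ 2 := by
          rw [lintegral_const_mul' _ _ (by finiteness), eLpNorm_two_sq]
      _ = 4 * (ENNReal.ofReal ((2 : ℝ) ^ (-(j : ℝ) / 2)) *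
          eLpNorm g 2 (volume.restrict (dyadicShell d j))) ^ 2 * (2⁻¹ : ℝ≥0∞) ^ j := by
          have h5 : ENNReal.ofReal ((2 : ℝ) ^ (-(j : ℝ) / 2)) ^ 2 = (2⁻¹ : ℝ≥0∞) ^ j := by
            rw [← ENNReal.ofReal_pow (by positivity), ← Real.rpow_natCast, ← Real.rpow_mul (by norm_num)]
            rw [show -(j : ℝ) / 2 * (2 : ℕ) = -(j : ℝ) by push_cast; ring, Real.rpow_neg (by norm_num),
              Real.rpow_natCast, ENNReal.ofReal_inv_of_pos (by positivity),
              ENNReal.ofReal_pow (by norm_num), ENNReal.inv_pow]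
            norm_num
          rw [mul_pow, h5]
          ring
      _ ≤ _ := by
          gcongr
          exact le_iSup (fun j : ℕ => ENNReal.ofReal ((2 : ℝ) ^ (-(j : ℝ) / 2)) *
            eLpNorm g 2 (volume.restrict (dyadicShell d j))) j
  refine (ENNReal.pow_le_pow_left_iff two_ne_zero).1 ?_
  rw [eLpNorm_two_sq, ← setLIntegral_univ, ← iUnion_dyadicShell d]
  refine (lintegral_iUnion_le _ _).trans ?_
  refine (ENNReal.tsum_le_tsum hj).trans ?_
  rw [ENNReal.tsum_mul_left, ENNReal.tsum_geometric, ENNReal.one_sub_inv_two, inv_inv, mul_pow]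
  rw [mul_right_comm]
  gcongr
  norm_num

/-! ### The symbols of the Littlewood–Paley projectors -/

/-- The symbol of `P_k` in the variable of Mathlib's Fourier transform. -/
def lpSymb {d : ℕ} (φ : 𝓢(Euc d, ℂ)) (k : ℤ) (ξ : Euc d) : ℂ :=
  lpPsi φ ((2 * π / (2 : ℝ) ^ k) • ξ)

/-- The symbol of `P_{≤ k}` in the variable of Mathlib's Fourier transform. -/
def lpSymbLe {d : ℕ} (φ : 𝓢(Euc d, ℂ)) (k : ℤ) (ξ : Euc d) : ℂ :=
  φ ((2 * π / (2 : ℝ) ^ k) • ξ)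

/-- This form makes sums of consecutive projectors telescope. -/
theorem lpSymb_eq_sub {d : ℕ} (φ : 𝓢(Euc d, ℂ)) (k : ℤ) :
    lpSymb φ k = lpSymbLe φ k - lpSymbLe φ (k - 1) := by
  ext ξ
  simp only [lpSymb, lpSymbLe, lpPsi, Pi.sub_apply, smul_smul]
  congr 3
  rw [zpow_sub_one₀ two_ne_zero]
  field_simp

theorem hasTemperateGrowth_lpSymbLe {d : ℕ} (φ : 𝓢(Euc d, ℂ)) (k : ℤ) :
    Function.HasTemperateGrowth (lpSymbLe φ k) :=
  hasTemperateGrowth_dilate φ _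

theorem hasTemperateGrowth_lpSymb {d : ℕ} (φ : 𝓢(Euc d, ℂ)) (k : ℤ) :
    Function.HasTemperateGrowth (lpSymb φ k) := by
  rw [lpSymb_eq_sub]
  exact (hasTemperateGrowth_lpSymbLe φ k).sub (hasTemperateGrowth_lpSymbLe φ (k - 1))

theorem norm_dilate_two_pi {d : ℕ} (k : ℤ) (ξ : Euc d) :
    ‖(2 * π / (2 : ℝ) ^ k) • ξ‖ = 2 * π * ‖ξ‖ / (2 : ℝ) ^ k := by
  rw [norm_smul, Real.norm_eq_abs, abs_of_pos (by positivity)]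
  ring

theorem lpSymbLe_eq_one {d : ℕ} {φ : 𝓢(Euc d, ℂ)} (hφ_one : ∀ ξ : Euc d, ‖ξ‖ ≤ 1 → φ ξ = 1)
    {k : ℤ} {ξ : Euc d} (h : 2 * π * ‖ξ‖ ≤ (2 : ℝ) ^ k) : lpSymbLe φ k ξ = 1 :=
  hφ_one _ (by rwa [norm_dilate_two_pi, div_le_one (by positivity)])

theorem lpSymbLe_eq_zero {d : ℕ} {φ : 𝓢(Euc d, ℂ)} (hφ_supp : tsupport φ ⊆ Metric.closedBall 0 2)
    {k : ℤ} {ξ : Euc d} (h : (2 : ℝ) ^ (k + 1) < 2 * π * ‖ξ‖) : lpSymbLe φ k ξ = 0 := by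
  refine image_eq_zero_of_notMem_tsupport (f := φ) fun hmem => ?_
  have := hφ_supp hmem
  rw [mem_closedBall_zero_iff, norm_dilate_two_pi, div_le_iff₀ (by positivity)] at this
  rw [zpow_add_one₀ two_ne_zero] at h
  linarith

/-- The frequencies of `P_k`. -/
def lpAnnulus (d : ℕ) (k : ℤ) : Set (Euc d) :=
  {ξ | (2 : ℝ) ^ (k - 1) ≤ 2 * π * ‖ξ‖ ∧ 2 * π * ‖ξ‖ ≤ (2 : ℝ) ^ (k + 1)}

theorem lpSymb_eq_zero {d : ℕ} {φ : 𝓢(Euc d, ℂ)} (hφ_supp : tsupport φ ⊆ Metric.closedBall 0 2)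
    (hφ_one : ∀ ξ : Euc d, ‖ξ‖ ≤ 1 → φ ξ = 1)
    {k : ℤ} {ξ : Euc d} (h : ξ ∉ lpAnnulus d k) : lpSymb φ k ξ = 0 := by
  rw [lpSymb_eq_sub, Pi.sub_apply]
  have h2 : (2 : ℝ) ^ (k - 1) ≤ (2 : ℝ) ^ k := zpow_le_zpow_right₀ one_le_two (by lia)
  have h3 : (2 : ℝ) ^ k ≤ (2 : ℝ) ^ (k + 1) := zpow_le_zpow_right₀ one_le_two (by lia)
  simp only [lpAnnulus, Set.mem_ofPred_eq, not_and_or, not_le] at h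
  rcases h with h | h
  · rw [lpSymbLe_eq_one hφ_one (h.le.trans h2), lpSymbLe_eq_one hφ_one h.le, sub_self]
  · rw [lpSymbLe_eq_zero hφ_supp h, lpSymbLe_eq_zero hφ_supp (by simpa using h3.trans_lt h),
      sub_self]

theorem fourier_lpProj_apply {d : ℕ} (φ : 𝓢(Euc d, ℂ)) (k : ℤ) (u : 𝓢'(Euc d, ℂ))
    (f : 𝓢(Euc d, ℂ)) :
    𝓕 (lpProj φ k u) f = 𝓕 u (SchwartzMap.smulLeftCLM ℂ (lpSymb φ k) f) := by
  rw [lpProj, TemperedDistribution.fourierMultiplierCLM_apply, fourier_fourierInv_eq]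
  rfl

theorem fourier_lpProjLe_apply {d : ℕ} (φ : 𝓢(Euc d, ℂ)) (k : ℤ) (u : 𝓢'(Euc d, ℂ))
    (f : 𝓢(Euc d, ℂ)) :
    𝓕 (lpProjLe φ k u) f = 𝓕 u (SchwartzMap.smulLeftCLM ℂ (lpSymbLe φ k) f) := by
  rw [lpProjLe, TemperedDistribution.fourierMultiplierCLM_apply, fourier_fourierInv_eq]
  rfl

theorem fourier_lpProj_apply_eq_sub {d : ℕ} (φ : 𝓢(Euc d, ℂ)) (k : ℤ) (u : 𝓢'(Euc d, ℂ))
    (f : 𝓢(Euc d, ℂ)) :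
    𝓕 (lpProj φ k u) f = 𝓕 (lpProjLe φ k u) f - 𝓕 (lpProjLe φ (k - 1) u) f := by
  rw [fourier_lpProj_apply, fourier_lpProjLe_apply, fourier_lpProjLe_apply, ← _root_.map_sub,
    lpSymb_eq_sub, SchwartzMap.smulLeftCLM_sub (hasTemperateGrowth_lpSymbLe φ k)
      (hasTemperateGrowth_lpSymbLe φ (k - 1))]
  rfl

theorem smulLeftCLM_eq_zero {d : ℕ} {m : Euc d → ℂ} (hm : m.HasTemperateGrowth)
    {f : 𝓢(Euc d, ℂ)} (h : ∀ ξ, m ξ ≠ 0 → f ξ = 0) : SchwartzMap.smulLeftCLM ℂ m f = 0 := by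
  ext ξ
  rw [SchwartzMap.smulLeftCLM_apply_apply hm, smul_eq_mul, zero_apply, mul_eq_zero]
  by_contra! hc
  exact hc.2 (h ξ hc.1)

/-- The symbol of `P_{≤ m+n}` is `1` on the support of `f`, and `P_{≤ m+n}` telescopes. The sum is
finite, so no convergence of a Littlewood–Paley series is involved. -/
theorem fourier_apply_eq_add_sum {d : ℕ} {φ : 𝓢(Euc d, ℂ)}
    (hφ_one : ∀ ξ : Euc d, ‖ξ‖ ≤ 1 → φ ξ = 1) (u : 𝓢'(Euc d, ℂ)) (f : 𝓢(Euc d, ℂ)) (m : ℤ) (n : ℕ)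
    (hf : ∀ ξ, f ξ ≠ 0 → 2 * π * ‖ξ‖ ≤ (2 : ℝ) ^ (m + n)) :
    𝓕 u f = 𝓕 (lpProjLe φ m u) f + ∑ i ∈ Finset.range n, 𝓕 (lpProj φ (m + 1 + i) u) f := by
  have h1 : 𝓕 u f = 𝓕 (lpProjLe φ (m + n) u) f := by
    rw [fourier_lpProjLe_apply]
    congr 1
    ext ξ
    rw [SchwartzMap.smulLeftCLM_apply_apply (hasTemperateGrowth_lpSymbLe φ _), smul_eq_mul]
    by_cases h : f ξ = 0
    · rw [h, mul_zero]
    · rw [lpSymbLe_eq_one hφ_one (hf ξ h), one_mul]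
  rw [h1]
  clear h1 hf
  induction n with
  | zero => simp
  | succ n ih =>
    rw [Finset.sum_range_succ, ← add_assoc, ← ih, fourier_lpProj_apply_eq_sub,
      show m + 1 + (n : ℤ) - 1 = m + n by ring, show m + 1 + (n : ℤ) = m + (n + 1 : ℕ) by
        push_cast; ring]
    ring

theorem exists_zpow_bound {d : ℕ} {K : Set (Euc d)} (hK : IsCompact K) (m : ℤ) (n₀ : ℕ) :
    ∃ n ≥ n₀, ∀ ξ ∈ K, 2 * π * ‖ξ‖ ≤ (2 : ℝ) ^ (m + (n : ℕ)) := by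
  obtain ⟨B, hB⟩ := hK.isBounded.exists_norm_le
  have hlim : Tendsto (fun n : ℕ => (2 : ℝ) ^ (m + n)) atTop atTop := by
    simp only [zpow_add₀ (two_ne_zero (α := ℝ)), zpow_natCast]
    exact (tendsto_pow_atTop_atTop_of_one_lt one_lt_two).const_mul_atTop (by positivity)
  obtain ⟨n, hn, hn0⟩ := ((hlim.eventually_ge_atTop (2 * π * B)).and (eventually_ge_atTop n₀)).exists
  refine ⟨n, hn0, fun ξ hξ => le_trans ?_ hn⟩
  gcongr
  exact hB ξ hξ

/-! ### Localization of the pieces -/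

/-- A test function supported off the closed annulus is annihilated by the symbol. -/
theorem ae_eq_zero_of_fourier_lpProj {d : ℕ} {φ : 𝓢(Euc d, ℂ)}
    (hφ_supp : tsupport φ ⊆ Metric.closedBall 0 2)
    (hφ_one : ∀ ξ : Euc d, ‖ξ‖ ≤ 1 → φ ξ = 1) {k : ℤ} {u : 𝓢'(Euc d, ℂ)} {h : Euc d → ℂ}
    (hh : IsGivenBy (𝓕 (lpProj φ k u)) h) : ∀ᵐ ξ, ξ ∉ lpAnnulus d k → h ξ = 0 := by
  have hc : IsClosed (lpAnnulus d k) :=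
    (isClosed_le continuous_const (continuous_norm.const_mul _)).inter
      (isClosed_le (continuous_norm.const_mul _) continuous_const)
  refine hh.ae_eq_zero_of_isOpen hc.isOpen_compl fun f _ hf => ?_
  rw [fourier_lpProj_apply, smulLeftCLM_eq_zero (hasTemperateGrowth_lpSymb φ k), _root_.map_zero]
  intro ξ hξ
  by_contra hne
  exact hξ (lpSymb_eq_zero hφ_supp hφ_one (hf (subset_tsupport _ hne)))

theorem ae_eq_zero_of_fourier_lpProjLe {d : ℕ} {φ : 𝓢(Euc d, ℂ)}
    (hφ_supp : tsupport φ ⊆ Metric.closedBall 0 2) {k : ℤ} {u : 𝓢'(Euc d, ℂ)} {h : Euc d → ℂ}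
    (hh : IsGivenBy (𝓕 (lpProjLe φ k u)) h) :
    ∀ᵐ ξ, (2 : ℝ) ^ (k + 1) < 2 * π * ‖ξ‖ → h ξ = 0 := by
  have hc : IsOpen {ξ : Euc d | (2 : ℝ) ^ (k + 1) < 2 * π * ‖ξ‖} :=
    isOpen_lt continuous_const (continuous_norm.const_mul _)
  refine hh.ae_eq_zero_of_isOpen hc fun f _ hf => ?_
  rw [fourier_lpProjLe_apply, smulLeftCLM_eq_zero (hasTemperateGrowth_lpSymbLe φ k),
    _root_.map_zero]
  intro ξ hξ
  by_contra hne
  exact hξ (lpSymbLe_eq_zero hφ_supp (hf (subset_tsupport _ hne)))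

/-! ### Comparison of the weights -/

/-- The frequency weight `1 + |2πξ|`. -/
def freqWeight {d : ℕ} (ξ : Euc d) : ℝ := 1 + 2 * π * ‖ξ‖

theorem one_le_freqWeight {d : ℕ} (ξ : Euc d) : 1 ≤ freqWeight ξ := by
  unfold freqWeight
  have : 0 ≤ 2 * π * ‖ξ‖ := by positivity
  linarith

theorem continuous_freqWeight {d : ℕ} : Continuous (freqWeight (d := d)) := by
  unfold freqWeight; fun_prop

/-- Put `r = 2π|ξ|`. Here `r ≤ √λ/2` and `1 ≤ √λ`, so `(1 + r)² ≤ (9/4) λ = 3 · (3/4) λ ≤ 3 (λ -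
r²)`. -/
theorem freqWeight_sq_le_of_le {d : ℕ} {lam : ℝ} (hlam : 1 < lam) {ξ : Euc d}
    (h : 2 * π * ‖ξ‖ ≤ (2 : ℝ) ^ (critScale lam - 2)) :
    freqWeight ξ ^ 2 ≤ 3 * symbM lam ((2 * π) • ξ) := by
  have h0 : 0 ≤ 2 * π * ‖ξ‖ := by positivity
  have h1 := (critScale_spec (zero_lt_one.trans hlam)).1
  have h2 : (2 : ℝ) ^ (critScale lam - 2) = (2 : ℝ) ^ (critScale lam - 1) / 2 := by
    rw [show critScale lam - 2 = critScale lam - 1 - 1 by ring, zpow_sub_one₀ two_ne_zero]; rfl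
  have h3 : 1 ≤ √lam := Real.one_le_sqrt.2 hlam.le
  have h4 : √lam ^ 2 = lam := Real.sq_sqrt (by linarith)
  have h5 : 2 * π * ‖ξ‖ ≤ √lam / 2 := by linarith
  have h6 : ‖(2 * π) • ξ‖ = 2 * π * ‖ξ‖ := by
    rw [norm_smul, Real.norm_eq_abs, abs_of_pos (by positivity)]
  unfold freqWeight symbM
  rw [h6]
  generalize 2 * π * ‖ξ‖ = r at *
  have h7 := le_abs_self (lam - r ^ 2)
  nlinarith

/-- Put `r = 2π|ξ|`. Here `1 ≤ √λ ≤ r/2`, so `(1 + r)² ≤ (9/4) r² = 3 · (3/4) r² ≤ 3 (r² - λ)`. -/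
theorem freqWeight_sq_le_of_ge {d : ℕ} {lam : ℝ} (hlam : 1 < lam) {ξ : Euc d}
    (h : (2 : ℝ) ^ (critScale lam + 1) ≤ 2 * π * ‖ξ‖) :
    freqWeight ξ ^ 2 ≤ 3 * symbM lam ((2 * π) • ξ) := by
  have h0 : 0 ≤ 2 * π * ‖ξ‖ := by positivity
  have h1 := (critScale_spec (zero_lt_one.trans hlam)).2
  have h2 : (2 : ℝ) ^ (critScale lam + 1) = (2 : ℝ) ^ (critScale lam) * 2 :=
    zpow_add_one₀ two_ne_zero _
  have h3 : 1 ≤ √lam := Real.one_le_sqrt.2 hlam.le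
  have h4 : √lam ^ 2 = lam := Real.sq_sqrt (by linarith)
  have h5 : 2 * √lam ≤ 2 * π * ‖ξ‖ := by linarith
  have h6 : ‖(2 * π) • ξ‖ = 2 * π * ‖ξ‖ := by
    rw [norm_smul, Real.norm_eq_abs, abs_of_pos (by positivity)]
  unfold freqWeight symbM
  rw [h6]
  generalize 2 * π * ‖ξ‖ = r at *
  have h7 := neg_abs_le (lam - r ^ 2)
  nlinarith

theorem normM_sq {d : ℕ} (lam : ℝ) (g : Euc d → ℂ) : normM lam g ^ 2 =
    ∫⁻ ξ, ENNReal.ofReal (symbM lam ((2 * π) • ξ)) * ‖g ξ‖ₑ ^ 2 := by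
  unfold normM
  rw [eLpNorm_two_sq]
  congr 1
  ext ξ
  have h : 0 ≤ symbM lam ((2 * π) • ξ) := abs_nonneg _
  rw [enorm_mul, mul_pow, ← ofReal_norm, Complex.norm_real, Real.norm_eq_abs,
    abs_of_nonneg (Real.sqrt_nonneg _), ← ENNReal.ofReal_pow (Real.sqrt_nonneg _), Real.sq_sqrt h]

theorem ofReal_freqWeight_sq_mul_le {d : ℕ} {lam : ℝ} {ξ : Euc d} {z : ℂ}
    (h : z ≠ 0 → freqWeight ξ ^ 2 ≤ 3 * symbM lam ((2 * π) • ξ)) :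
    ENNReal.ofReal (freqWeight ξ) ^ 2 * ‖z‖ₑ ^ 2 ≤
      3 * (ENNReal.ofReal (symbM lam ((2 * π) • ξ)) * ‖z‖ₑ ^ 2) := by
  rcases eq_or_ne z 0 with rfl | hz
  · simp
  · rw [← mul_assoc]
    gcongr
    rw [← ENNReal.ofReal_pow (by linarith [one_le_freqWeight ξ])]
    refine (ENNReal.ofReal_le_ofReal (h hz)).trans ?_
    rw [ENNReal.ofReal_mul (by norm_num)]
    norm_num

/-- At most three terms are nonzero, because a point lies in at most three of the annuli; the
constant is their number, by Cauchy–Schwarz. -/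
theorem sq_tsum_le_of_annuli {d : ℕ} {h : ℤ → ℂ} {ξ : Euc d}
    (hh : ∀ k, h k ≠ 0 → ξ ∈ lpAnnulus d k) : (∑' k, ‖h k‖ₑ) ^ 2 ≤ 3 * ∑' k, ‖h k‖ₑ ^ 2 := by
  set r := 2 * π * ‖ξ‖ with hr
  -- The value at `r = 0` does not matter: the origin lies in no annulus.
  set n := Int.log 2 r with hn
  have hk : ∀ k ∉ Finset.Icc (n - 1) (n + 1), h k = 0 := by
    intro k hk
    by_contra hne
    obtain ⟨h1, h2⟩ := hh k hne
    have hr0 : 0 < r := lt_of_lt_of_le (by positivity) h1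
    have h3 : (2 : ℝ) ^ n ≤ r := by simpa using Int.zpow_log_le_self (b := 2) one_lt_two hr0
    have h4 : r < (2 : ℝ) ^ (n + 1) := by
      simpa using Int.lt_zpow_succ_log_self (b := 2) one_lt_two r
    have h5 := (zpow_lt_zpow_iff_right₀ (one_lt_two (α := ℝ))).1 (h1.trans_lt h4)
    have h6 := (zpow_le_zpow_iff_right₀ (one_lt_two (α := ℝ))).1 (h3.trans h2)
    exact hk (Finset.mem_Icc.2 ⟨by lia, by lia⟩)
  rw [tsum_eq_sum (s := Finset.Icc (n - 1) (n + 1)) fun k hk' => by rw [hk k hk', enorm_zero],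
    tsum_eq_sum (s := Finset.Icc (n - 1) (n + 1)) fun k hk' => by
      rw [hk k hk', enorm_zero]; norm_num]
  have h7 := ENNReal.rpow_sum_le_const_mul_sum_rpow (Finset.Icc (n - 1) (n + 1))
    (fun k => ‖h k‖ₑ) (p := 2) one_le_two
  have h8 : (Finset.Icc (n - 1) (n + 1)).card = 3 := by simp; lia
  rw [h8] at h7
  norm_num at h7
  exact h7

/-! ### The pieces of an element of `Y_lam^*` -/

theorem distNorm_low_sq_le {d : ℕ} (φ : 𝓢(Euc d, ℂ)) (lam : ℝ) (u : 𝓢'(Euc d, ℂ)) :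
    distNorm (normM lam) (𝓕 (lpProjLe φ (critScale lam - 3) u)) ^ 2 ≤ yStarSq φ lam u := by
  rw [← ENNReal.rpow_two, yStarSq, add_assoc]
  exact le_self_add

theorem distNorm_normStar_le {d : ℕ} (φ : 𝓢(Euc d, ℂ)) {lam : ℝ} (hlam : 1 < lam)
    (u : 𝓢'(Euc d, ℂ)) {k : ℤ} (hk : k ∈ Finset.Icc (critScale lam - 2) (critScale lam + 1)) :
    distNorm normStar (lpProj φ k u) ≤ yStarSq φ lam u ^ (1 / 2 : ℝ) := by
  rw [one_div, ENNReal.le_rpow_inv_iff two_pos]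
  have h1 : 1 ≤ ENNReal.ofReal (√lam) := by
    rw [← ENNReal.ofReal_one]
    exact ENNReal.ofReal_le_ofReal (Real.one_le_sqrt.2 hlam.le)
  calc _ ≤ ENNReal.ofReal (√lam) * distNorm normStar (lpProj φ k u) ^ (2 : ℝ) :=
        le_mul_of_one_le_left' h1
    _ ≤ ∑ k ∈ Finset.Icc (critScale lam - 2) (critScale lam + 1),
        ENNReal.ofReal (√lam) * distNorm normStar (lpProj φ k u) ^ (2 : ℝ) :=
        Finset.single_le_sum (f := fun k => ENNReal.ofReal (√lam) *
          distNorm normStar (lpProj φ k u) ^ (2 : ℝ)) (fun _ _ => zero_le) hk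
    _ ≤ _ := by
        rw [yStarSq]
        exact le_add_self.trans le_self_add

theorem distNorm_high_tsum_le {d : ℕ} (φ : 𝓢(Euc d, ℂ)) (lam : ℝ) (u : 𝓢'(Euc d, ℂ)) :
    distNorm (normM lam) (𝓕 (lpProjLe φ (critScale lam - 3) u)) ^ 2 +
      ∑' k : Set.Ioi (critScale lam + 1), distNorm (normM lam) (𝓕 (lpProj φ k u)) ^ 2 ≤
      yStarSq φ lam u := by
  simp only [← ENNReal.rpow_two]
  rw [yStarSq]
  exact add_le_add_left le_self_add _

theorem lt_top_of_sq_le {a b : ℝ≥0∞} (h : a ^ 2 ≤ b) (hb : b < ⊤) : a < ⊤ := by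
  refine lt_top_iff_ne_top.2 fun ha => ?_
  rw [ha] at h
  exact absurd (h.trans_lt hb) (by simp)

/-- The representative is cut off so that the support condition holds at every point and the weights
can be compared pointwise. -/
theorem exists_isGivenBy_low {d : ℕ} {φ : 𝓢(Euc d, ℂ)}
    (hφ_supp : tsupport φ ⊆ Metric.closedBall 0 2) {lam : ℝ} {u : 𝓢'(Euc d, ℂ)}
    (hu : yStarSq φ lam u < ⊤) :
    ∃ h, IsGivenBy (𝓕 (lpProjLe φ (critScale lam - 3) u)) h ∧
      normM lam h = distNorm (normM lam) (𝓕 (lpProjLe φ (critScale lam - 3) u)) ∧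
      ∀ ξ, h ξ ≠ 0 → 2 * π * ‖ξ‖ ≤ (2 : ℝ) ^ (critScale lam - 2) := by
  obtain ⟨h, hh, hN⟩ := exists_isGivenBy_of_distNorm_lt_top (aeInvariant_normM lam)
    (lt_top_of_sq_le (distNorm_low_sq_le φ lam u) hu)
  have hz := ae_eq_zero_of_fourier_lpProjLe hφ_supp hh
  rw [show critScale lam - 3 + 1 = critScale lam - 2 by ring] at hz
  have heq : h =ᵐ[volume]
      {ξ | 2 * π * ‖ξ‖ ≤ (2 : ℝ) ^ (critScale lam - 2)}.indicator h := by
    filter_upwards [hz] with ξ hξ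
    by_cases hm : 2 * π * ‖ξ‖ ≤ (2 : ℝ) ^ (critScale lam - 2)
    · rw [Set.indicator_of_mem (by exact hm)]
    · rw [Set.indicator_of_notMem (by exact hm), hξ (not_le.1 hm)]
  refine ⟨_, hh.congr_ae heq, (aeInvariant_normM lam _ _ heq).symm.trans hN, fun ξ hξ => ?_⟩
  exact Set.mem_of_indicator_ne_zero
    (s := {ξ : Euc d | 2 * π * ‖ξ‖ ≤ (2 : ℝ) ^ (critScale lam - 2)}) hξ

theorem exists_isGivenBy_high {d : ℕ} {φ : 𝓢(Euc d, ℂ)}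
    (hφ_supp : tsupport φ ⊆ Metric.closedBall 0 2)
    (hφ_one : ∀ ξ : Euc d, ‖ξ‖ ≤ 1 → φ ξ = 1) {lam : ℝ} {u : 𝓢'(Euc d, ℂ)}
    (hu : yStarSq φ lam u < ⊤) {k : ℤ} (hk : k ∈ Set.Ioi (critScale lam + 1)) :
    ∃ h, IsGivenBy (𝓕 (lpProj φ k u)) h ∧
      normM lam h = distNorm (normM lam) (𝓕 (lpProj φ k u)) ∧
      ∀ ξ, h ξ ≠ 0 → ξ ∈ lpAnnulus d k := by
  have hlt : distNorm (normM lam) (𝓕 (lpProj φ k u)) ^ 2 ≤ yStarSq φ lam u :=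
    (ENNReal.le_tsum (f := fun k : Set.Ioi (critScale lam + 1) =>
      distNorm (normM lam) (𝓕 (lpProj φ k u)) ^ 2) ⟨k, hk⟩).trans
      (le_add_self.trans (distNorm_high_tsum_le φ lam u))
  obtain ⟨h, hh, hN⟩ := exists_isGivenBy_of_distNorm_lt_top (aeInvariant_normM lam)
    (lt_top_of_sq_le hlt hu)
  have hz := ae_eq_zero_of_fourier_lpProj hφ_supp hφ_one hh
  have heq : h =ᵐ[volume] (lpAnnulus d k).indicator h := by
    filter_upwards [hz] with ξ hξ
    by_cases hm : ξ ∈ lpAnnulus d k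
    · rw [Set.indicator_of_mem hm]
    · rw [Set.indicator_of_notMem hm, hξ hm]
  refine ⟨_, hh.congr_ae heq, (aeInvariant_normM lam _ _ heq).symm.trans hN, fun ξ hξ => ?_⟩
  exact Set.mem_of_indicator_ne_zero hξ

/-- The pieces of `u` of high and of low frequency are functions on the Fourier side, with a common
majorant in a weighted `L²` space. -/
theorem exists_majorant {d : ℕ} {φ : 𝓢(Euc d, ℂ)}
    (hφ_supp : tsupport φ ⊆ Metric.closedBall 0 2)
    (hφ_one : ∀ ξ : Euc d, ‖ξ‖ ≤ 1 → φ ξ = 1) {lam : ℝ} (hlam : 1 < lam) {u : 𝓢'(Euc d, ℂ)}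
    (hu : yStarSq φ lam u < ⊤) :
    ∃ H : Euc d → ℝ≥0∞, AEMeasurable H volume ∧
      ∫⁻ ξ, ENNReal.ofReal (freqWeight ξ) ^ 2 * H ξ ^ 2 ≤ 18 * yStarSq φ lam u ∧
      ∀ (f : 𝓢(Euc d, ℂ)), HasCompactSupport f → ∀ s : Finset ℤ,
        (∀ k ∈ s, critScale lam + 1 < k) →
        ‖𝓕 (lpProjLe φ (critScale lam - 3) u) f‖ₑ + ∑ k ∈ s, ‖𝓕 (lpProj φ k u) f‖ₑ ≤
          ∫⁻ ξ, ‖f ξ‖ₑ * H ξ := by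
  obtain ⟨h₀, hh₀, hN₀, hs₀⟩ := exists_isGivenBy_low hφ_supp hu
  -- Scales outside the high range receive the zero function, so that the sums below run over all of
  -- `ℤ`.
  have hex : ∀ k : ℤ, ∃ h : Euc d → ℂ, AEStronglyMeasurable h volume ∧
      (k ∈ Set.Ioi (critScale lam + 1) → IsGivenBy (𝓕 (lpProj φ k u)) h) ∧
      (normM lam h ^ 2 = (Set.Ioi (critScale lam + 1)).indicator
        (fun k => distNorm (normM lam) (𝓕 (lpProj φ k u)) ^ 2) k) ∧
      ∀ ξ, h ξ ≠ 0 → ξ ∈ lpAnnulus d k ∧ k ∈ Set.Ioi (critScale lam + 1) := fun k => by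
    by_cases hk : k ∈ Set.Ioi (critScale lam + 1)
    · obtain ⟨h, hh, hN, hs⟩ := exists_isGivenBy_high hφ_supp hφ_one hu hk
      exact ⟨h, hh.1.aestronglyMeasurable, fun _ => hh, by rw [Set.indicator_of_mem hk, hN],
        fun ξ hξ => ⟨hs ξ hξ, hk⟩⟩
    · refine ⟨0, aestronglyMeasurable_const, fun h => absurd h hk, ?_, fun ξ hξ => absurd rfl hξ⟩
      rw [Set.indicator_of_notMem hk, normM_sq]
      simp
  choose h hm hg hN hs using hex
  have hm₀ := hh₀.1.aestronglyMeasurable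
  have hmt : AEMeasurable (fun ξ => ∑' k, ‖h k ξ‖ₑ) volume :=
    AEMeasurable.tsum fun k => (hm k).enorm
  refine ⟨fun ξ => ‖h₀ ξ‖ₑ + ∑' k, ‖h k ξ‖ₑ, hm₀.enorm.add hmt, ?_, ?_⟩
  · have hw : Measurable fun ξ : Euc d => ENNReal.ofReal (symbM lam ((2 * π) • ξ)) := by
      refine (Continuous.measurable ?_).ennreal_ofReal
      unfold symbM; fun_prop
    -- The constant is `18 = 2 · 3 · 3`: separating low from high frequencies, the overlap of the
    -- annuli, and the comparison of the weights.
    have hpt : ∀ ξ : Euc d, ENNReal.ofReal (freqWeight ξ) ^ 2 *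
        (‖h₀ ξ‖ₑ + ∑' k, ‖h k ξ‖ₑ) ^ 2 ≤
        18 * (ENNReal.ofReal (symbM lam ((2 * π) • ξ)) * ‖h₀ ξ‖ₑ ^ 2 +
          ∑' k, ENNReal.ofReal (symbM lam ((2 * π) • ξ)) * ‖h k ξ‖ₑ ^ 2) := fun ξ => by
      set a := ENNReal.ofReal (freqWeight ξ) with ha
      set b := ENNReal.ofReal (symbM lam ((2 * π) • ξ)) with hb
      have h1 : a ^ 2 * ‖h₀ ξ‖ₑ ^ 2 ≤ 3 * (b * ‖h₀ ξ‖ₑ ^ 2) :=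
        ofReal_freqWeight_sq_mul_le fun hne => freqWeight_sq_le_of_le hlam (hs₀ ξ hne)
      have h2 : ∀ k, a ^ 2 * ‖h k ξ‖ₑ ^ 2 ≤ 3 * (b * ‖h k ξ‖ₑ ^ 2) := fun k =>
        ofReal_freqWeight_sq_mul_le fun hne => by
          obtain ⟨h3, h4⟩ := hs k ξ hne
          refine freqWeight_sq_le_of_ge hlam (le_trans ?_ h3.1)
          refine zpow_le_zpow_right₀ one_le_two ?_
          have : critScale lam + 1 < k := h4
          lia
      have h5 : (∑' k, ‖h k ξ‖ₑ) ^ 2 ≤ 3 * ∑' k, ‖h k ξ‖ₑ ^ 2 :=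
        sq_tsum_le_of_annuli fun k hne => (hs k ξ hne).1
      have h6 : ∀ x y : ℝ≥0∞, (x + y) ^ 2 ≤ 2 * (x ^ 2 + y ^ 2) := fun x y => by
        have := ENNReal.rpow_add_le_mul_rpow_add_rpow x y (p := 2) one_le_two
        norm_num at this
        exact this
      calc _ ≤ a ^ 2 * (2 * (‖h₀ ξ‖ₑ ^ 2 + 3 * ∑' k, ‖h k ξ‖ₑ ^ 2)) := by
            gcongr
            exact (h6 _ _).trans (by gcongr)
        _ = 2 * (a ^ 2 * ‖h₀ ξ‖ₑ ^ 2) + 6 * ∑' k, a ^ 2 * ‖h k ξ‖ₑ ^ 2 := by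
            rw [ENNReal.tsum_mul_left]; ring
        _ ≤ 2 * (3 * (b * ‖h₀ ξ‖ₑ ^ 2)) + 6 * ∑' k, 3 * (b * ‖h k ξ‖ₑ ^ 2) := by
            exact add_le_add (mul_le_mul_right h1 2)
              (mul_le_mul_right (ENNReal.tsum_le_tsum h2) 6)
        _ = 6 * (b * ‖h₀ ξ‖ₑ ^ 2) + 18 * ∑' k, (b * ‖h k ξ‖ₑ ^ 2) := by
            rw [ENNReal.tsum_mul_left]; ring
        _ ≤ 18 * (b * ‖h₀ ξ‖ₑ ^ 2) + 18 * ∑' k, (b * ‖h k ξ‖ₑ ^ 2) := by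
            refine add_le_add (mul_le_mul_left ?_ _) le_rfl
            norm_num
        _ = _ := by ring
    have hM : ∀ {g : Euc d → ℂ}, AEStronglyMeasurable g volume → AEMeasurable
        (fun ξ => ENNReal.ofReal (symbM lam ((2 * π) • ξ)) * ‖g ξ‖ₑ ^ 2) volume := fun hg =>
      hw.aemeasurable.mul (hg.enorm.pow_const 2)
    calc _ ≤ ∫⁻ ξ, 18 * (ENNReal.ofReal (symbM lam ((2 * π) • ξ)) * ‖h₀ ξ‖ₑ ^ 2 +
          ∑' k, ENNReal.ofReal (symbM lam ((2 * π) • ξ)) * ‖h k ξ‖ₑ ^ 2) := lintegral_mono hpt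
      _ = 18 * (normM lam h₀ ^ 2 + ∑' k, normM lam (h k) ^ 2) := by
          rw [lintegral_const_mul' _ _ (by norm_num), lintegral_add_left' (hM hm₀),
            lintegral_tsum fun k => hM (hm k)]
          simp only [normM_sq]
      _ ≤ _ := by
          gcongr
          refine le_trans (le_of_eq ?_) (distNorm_high_tsum_le φ lam u)
          rw [hN₀]
          simp only [hN]
          rw [tsum_subtype (Set.Ioi (critScale lam + 1))
            (fun k => distNorm (normM lam) (𝓕 (lpProj φ k u)) ^ 2)]
  · intro f hf s hsk
    have hb : ∀ {T : 𝓢'(Euc d, ℂ)} {g : Euc d → ℂ}, IsGivenBy T g →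
        ‖T f‖ₑ ≤ ∫⁻ ξ, ‖f ξ‖ₑ * ‖g ξ‖ₑ := fun hT => by
      rw [hT.2 f hf]
      refine (enorm_integral_le_lintegral_enorm _).trans ?_
      simp only [enorm_mul]
      exact le_rfl
    have hfm : AEMeasurable (fun ξ => ‖f ξ‖ₑ) volume :=
      f.continuous.aestronglyMeasurable.enorm
    have hM : ∀ {g : Euc d → ℂ}, AEStronglyMeasurable g volume →
        AEMeasurable (fun ξ => ‖f ξ‖ₑ * ‖g ξ‖ₑ) volume := fun hg => hfm.mul hg.enorm
    calc _ ≤ (∫⁻ ξ, ‖f ξ‖ₑ * ‖h₀ ξ‖ₑ) + ∑ k ∈ s, ∫⁻ ξ, ‖f ξ‖ₑ * ‖h k ξ‖ₑ :=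
          add_le_add (hb hh₀) (Finset.sum_le_sum fun k hk => hb (hg k (hsk k hk)))
      _ = ∫⁻ ξ, ‖f ξ‖ₑ * (‖h₀ ξ‖ₑ + ∑ k ∈ s, ‖h k ξ‖ₑ) := by
          rw [← lintegral_finsetSum' _ fun k _ => hM (hm k), ← lintegral_add_left' (hM hm₀)]
          simp only [mul_add, Finset.mul_sum]
      _ ≤ _ := by
          refine lintegral_mono fun ξ => mul_le_mul_right (add_le_add le_rfl ?_) _
          exact ENNReal.sum_le_tsum s

/-- The pieces of `u` of intermediate frequency are functions on the physical side. -/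
theorem exists_isGivenBy_mid {d : ℕ} (φ : 𝓢(Euc d, ℂ)) {lam : ℝ} (hlam : 1 < lam)
    {u : 𝓢'(Euc d, ℂ)} (hu : yStarSq φ lam u < ⊤) {k : ℤ}
    (hk : k ∈ Finset.Icc (critScale lam - 2) (critScale lam + 1)) :
    ∃ g : Euc d → ℂ, AEStronglyMeasurable g volume ∧
      eLpNorm (fun x => (quadWeight x : ℂ)⁻¹ * g x) 2 volume ≤
        4 * yStarSq φ lam u ^ (1 / 2 : ℝ) ∧
      MemLp (fun x => (quadWeight x : ℂ)⁻¹ * g x) 2 volume ∧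
      ∀ f : 𝓢(Euc d, ℂ), 𝓕 (lpProj φ k u) f = ∫ x, 𝓕 f x * g x := by
  have hle := distNorm_normStar_le φ hlam u hk
  have hB : yStarSq φ lam u ^ (1 / 2 : ℝ) < ⊤ := ENNReal.rpow_lt_top_of_nonneg (by norm_num) hu.ne
  obtain ⟨g, hg, hN⟩ := exists_isGivenBy_of_distNorm_lt_top aeInvariant_normStar (hle.trans_lt hB)
  have hgm := hg.1.aestronglyMeasurable
  have h1 : eLpNorm (fun x => (quadWeight x : ℂ)⁻¹ * g x) 2 volume ≤
      4 * yStarSq φ lam u ^ (1 / 2 : ℝ) :=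
    (eLpNorm_quadWeight_inv_mul_le g).trans (by rw [hN]; gcongr)
  have h2 : MemLp (fun x => (quadWeight x : ℂ)⁻¹ * g x) 2 volume := by
    refine ⟨AEStronglyMeasurable.mul ?_ hgm, h1.trans_lt (ENNReal.mul_lt_top (by norm_num) hB)⟩
    exact (Complex.continuous_ofReal.comp continuous_quadWeight).measurable.inv.aestronglyMeasurable
  exact ⟨g, hgm, h1, h2, fun f => hg.apply_of_memLp h2 (𝓕 f)⟩

/-- The Fourier transform of `u` is bounded in terms of the norm of `Y_lam^*`; at high frequencies
the majorant suffices. -/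
theorem exists_enorm_fourier_apply_le {d : ℕ} {φ : 𝓢(Euc d, ℂ)}
    (hφ_supp : tsupport φ ⊆ Metric.closedBall 0 2)
    (hφ_one : ∀ ξ : Euc d, ‖ξ‖ ≤ 1 → φ ξ = 1) {lam : ℝ} (hlam : 1 < lam) {u : 𝓢'(Euc d, ℂ)}
    (hu : yStarSq φ lam u < ⊤) :
    ∃ H : Euc d → ℝ≥0∞, AEMeasurable H volume ∧
      ∫⁻ ξ, ENNReal.ofReal (freqWeight ξ) ^ 2 * H ξ ^ 2 ≤ 18 * yStarSq φ lam u ∧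
      (∀ f : 𝓢(Euc d, ℂ), HasCompactSupport f → ‖𝓕 u f‖ₑ ≤ (∫⁻ ξ, ‖f ξ‖ₑ * H ξ) +
        16 * yStarSq φ lam u ^ (1 / 2 : ℝ) *
          eLpNorm (fun x => (quadWeight x : ℂ) * 𝓕 f x) 2 volume) ∧
      ∀ f : 𝓢(Euc d, ℂ), HasCompactSupport f →
        (∀ ξ, f ξ ≠ 0 → (2 : ℝ) ^ (critScale lam + 2) < 2 * π * ‖ξ‖) →
          ‖𝓕 u f‖ₑ ≤ ∫⁻ ξ, ‖f ξ‖ₑ * H ξ := by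
  obtain ⟨H, hHm, hHi, hH⟩ := exists_majorant hφ_supp hφ_one hlam hu
  have hdec : ∀ f : 𝓢(Euc d, ℂ), HasCompactSupport f → ‖𝓕 u f‖ₑ ≤ (∫⁻ ξ, ‖f ξ‖ₑ * H ξ) +
      ∑ k ∈ Finset.Icc (critScale lam - 2) (critScale lam + 1), ‖𝓕 (lpProj φ k u) f‖ₑ := by
    intro f hf
    -- The bound `4 ≤ n` ensures that all four critical scales occur in the telescoping sum.
    obtain ⟨n, hn, hfn⟩ := exists_zpow_bound hf.isCompact (critScale lam - 3) 4
    have hsplit : ∑ i ∈ Finset.range n, 𝓕 (lpProj φ (critScale lam - 3 + 1 + i) u) f =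
        ∑ k ∈ Finset.Icc (critScale lam - 2) (critScale lam + 1), 𝓕 (lpProj φ k u) f +
        ∑ k ∈ Finset.Ioc (critScale lam + 1) (critScale lam - 3 + n), 𝓕 (lpProj φ k u) f := by
      rw [← Finset.sum_union (Finset.disjoint_left.2 fun k h1 h2 => by
        rw [Finset.mem_Icc] at h1; rw [Finset.mem_Ioc] at h2; lia)]
      refine Finset.sum_bij (fun i _ => critScale lam - 3 + 1 + i) ?_ ?_ ?_ ?_
      · intro i hi
        rw [Finset.mem_range] at hi
        rw [Finset.mem_union, Finset.mem_Icc, Finset.mem_Ioc]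
        lia
      · intro i _ j _ hij
        simpa using hij
      · intro k hk
        rw [Finset.mem_union, Finset.mem_Icc, Finset.mem_Ioc] at hk
        exact ⟨(k - (critScale lam - 2)).toNat, by rw [Finset.mem_range]; lia, by lia⟩
      · intro i _
        rfl
    rw [fourier_apply_eq_add_sum hφ_one u f _ n fun ξ hξ => hfn ξ (subset_tsupport _ hξ), hsplit, add_left_comm, add_comm]
    refine (enorm_add_le _ _).trans (add_le_add ?_ (enorm_sum_le _ _))
    refine le_trans ?_ (hH f hf (Finset.Ioc (critScale lam + 1) (critScale lam - 3 + n))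
      fun k hk => (Finset.mem_Ioc.1 hk).1)
    exact (enorm_add_le _ _).trans (add_le_add le_rfl (enorm_sum_le _ _))
  refine ⟨H, hHm, hHi, fun f hf => (hdec f hf).trans ?_, fun f hf hfs => (hdec f hf).trans ?_⟩
  · gcongr
    -- Four scales, each with the constant `4` of `exists_isGivenBy_mid`, give the factor `16`.
    have hk : ∀ k ∈ Finset.Icc (critScale lam - 2) (critScale lam + 1),
        ‖𝓕 (lpProj φ k u) f‖ₑ ≤ 4 * yStarSq φ lam u ^ (1 / 2 : ℝ) *
          eLpNorm (fun x => (quadWeight x : ℂ) * 𝓕 f x) 2 volume := fun k hk => by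
      obtain ⟨g, hgm, hgN, -, hg⟩ := exists_isGivenBy_mid φ hlam hu hk
      rw [hg f]
      exact (enorm_integral_mul_le_quadWeight (𝓕 f) hgm).trans (by gcongr)
    refine (Finset.sum_le_card_nsmul _ _ _ hk).trans (le_of_eq ?_)
    have hcard : (Finset.Icc (critScale lam - 2) (critScale lam + 1)).card = 4 := by simp; lia
    rw [hcard, nsmul_eq_mul]
    push_cast
    ring
  -- The highest critical scale is `critScale lam + 1`, whose symbol reaches no further than the
  -- angular frequency `2 ^ (critScale lam + 2)`; so the critical pieces do not see `f`.
  · refine le_of_eq ?_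
    rw [Finset.sum_eq_zero, add_zero]
    intro k hk
    rw [fourier_lpProj_apply, smulLeftCLM_eq_zero (hasTemperateGrowth_lpSymb φ k), _root_.map_zero,
      enorm_zero]
    intro ξ hξ
    by_contra hne
    refine hξ (lpSymb_eq_zero hφ_supp hφ_one fun hmem => ?_)
    refine absurd (hmem.2.trans ?_) (not_le.2 (hfs ξ hne))
    exact zpow_le_zpow_right₀ one_le_two (by have := (Finset.mem_Icc.1 hk).2; lia)

/-! ### Multiplication by a band-limited Schwartz function -/

/-- The Schwartz function `η ↦ κ(ξ - η)`. -/
def reflectShift {d : ℕ} (κ : 𝓢(Euc d, ℂ)) (ξ : Euc d) : 𝓢(Euc d, ℂ) :=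
  SchwartzMap.compSubConstCLM ℂ ξ
    (SchwartzMap.compCLMOfContinuousLinearEquiv ℂ (ContinuousLinearEquiv.neg ℝ) κ)

theorem reflectShift_apply {d : ℕ} (κ : 𝓢(Euc d, ℂ)) (ξ η : Euc d) :
    reflectShift κ ξ η = κ (ξ - η) := by
  simp [reflectShift]

/-- The shift `ξ` enters only through a unimodular factor, so weighted norms of the transform do not
depend on it. -/
theorem fourier_reflectShift {d : ℕ} (κ : 𝓢(Euc d, ℂ)) (ξ x : Euc d) :
    𝓕 (reflectShift κ ξ) x = (𝐞 (-inner ℝ x ξ) : ℂ) * 𝓕⁻ κ x := by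
  rw [SchwartzMap.fourier_coe, SchwartzMap.fourierInv_coe, Real.fourier_eq, Real.fourierInv_eq,
    ← integral_const_mul, ← integral_sub_left_eq_self _ volume ξ]
  congr 1
  ext η
  rw [reflectShift_apply, sub_sub_cancel, Circle.smul_def, Circle.smul_def, smul_eq_mul,
    smul_eq_mul, ← mul_assoc, ← Circle.coe_mul, ← AddChar.map_add_eq_mul, inner_sub_left,
    real_inner_comm x ξ]
  congr 4
  ring

theorem hasCompactSupport_reflectShift {d : ℕ} {κ : 𝓢(Euc d, ℂ)} (hκ : HasCompactSupport κ)
    (ξ : Euc d) : HasCompactSupport (reflectShift κ ξ) := by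
  have : (reflectShift κ ξ : Euc d → ℂ) = κ ∘ Homeomorph.subLeft ξ := by
    ext η; rw [reflectShift_apply]; rfl
  rw [this]
  exact hκ.comp_homeomorph _

/-- The inverse Fourier transform of the product of `𝓕⁻ κ` and `𝓕 f`. -/
def bandConv {d : ℕ} (κ f : 𝓢(Euc d, ℂ)) : 𝓢(Euc d, ℂ) :=
  𝓕⁻ (SchwartzMap.smulLeftCLM ℂ (𝓕⁻ κ : 𝓢(Euc d, ℂ)) (𝓕 f))

theorem fourier_bandConv_apply {d : ℕ} (κ f : 𝓢(Euc d, ℂ)) (x : Euc d) :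
    𝓕 (bandConv κ f) x = 𝓕⁻ κ x * 𝓕 f x := by
  rw [bandConv, fourier_fourierInv_eq,
    SchwartzMap.smulLeftCLM_apply_apply (𝓕⁻ κ : 𝓢(Euc d, ℂ)).hasTemperateGrowth, smul_eq_mul]

/-- `bandConv κ f` is what the test function `f` becomes when `𝓕⁻ κ` is moved off the distribution.
The formula is the multiplication formula `∫ 𝓕 a · b = ∫ a · 𝓕 b`, with `𝓕 𝓕 f = f(-·)`. -/
theorem bandConv_apply {d : ℕ} (κ f : 𝓢(Euc d, ℂ)) (η : Euc d) :
    bandConv κ f η = ∫ ξ, f ξ * κ (ξ - η) := by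
  have h1 : bandConv κ f η = ∫ x, 𝓕 (reflectShift κ (-η)) x * 𝓕 f x := by
    rw [bandConv, SchwartzMap.fourierInv_coe, Real.fourierInv_eq]
    congr 1
    ext x
    rw [fourier_reflectShift, SchwartzMap.smulLeftCLM_apply_apply
      (𝓕⁻ κ : 𝓢(Euc d, ℂ)).hasTemperateGrowth, Circle.smul_def, inner_neg_right, neg_neg,
      smul_eq_mul, smul_eq_mul, mul_assoc]
  have h2 : ∀ y, 𝓕 (𝓕 f) y = f (-y) := fun y => by
    conv_rhs => rw [← fourierInv_fourier_eq (F := 𝓢(Euc d, ℂ)) f]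
    rw [SchwartzMap.fourierInv_coe, Real.fourierInv_eq_fourier_neg, neg_neg]
    rfl
  rw [h1, SchwartzMap.integral_fourier_mul_eq, ← integral_neg_eq_self]
  congr 1
  ext ξ
  rw [reflectShift_apply, h2, neg_neg, mul_comm, neg_sub_neg]

theorem bandConv_support_subset {d : ℕ} (κ f : 𝓢(Euc d, ℂ)) :
    Function.support (bandConv κ f) ⊆ tsupport f - tsupport κ := by
  intro η hη
  by_contra hne
  refine hη ?_
  rw [bandConv_apply]
  refine integral_eq_zero_of_ae (Eventually.of_forall fun ξ => ?_)
  by_contra h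
  obtain ⟨h1, h2⟩ := mul_ne_zero_iff.1 h
  exact hne (Set.mem_sub.2 ⟨ξ, subset_tsupport _ h1, _, subset_tsupport _ h2, by abel⟩)

theorem isCompact_tsupport_sub {d : ℕ} {f g : 𝓢(Euc d, ℂ)} (hf : HasCompactSupport f)
    (hg : HasCompactSupport g) : IsCompact (tsupport f - tsupport g) := by
  rw [sub_eq_add_neg]
  exact IsCompact.add hf (IsCompact.neg hg)

theorem hasCompactSupport_bandConv {d : ℕ} {κ f : 𝓢(Euc d, ℂ)} (hκ : HasCompactSupport κ)
    (hf : HasCompactSupport f) : HasCompactSupport (bandConv κ f) :=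
  .of_support_subset_isCompact (isCompact_tsupport_sub hf hκ) (bandConv_support_subset κ f)

/-- The distribution `T` commutes with the integral that defines `bandConv κ f`. -/
def BandFubini {d : ℕ} (κ f : 𝓢(Euc d, ℂ)) (T : 𝓢'(Euc d, ℂ)) : Prop :=
  Integrable (fun ξ => f ξ * T (reflectShift κ ξ)) ∧
    T (bandConv κ f) = ∫ ξ, f ξ * T (reflectShift κ ξ)

/-- Only points of the compact set `tsupport f - tsupport κ` matter. There the locally integrable
`h` is integrable, and Fubini's theorem applies. -/
theorem BandFubini.of_isGivenBy {d : ℕ} {κ f : 𝓢(Euc d, ℂ)} (hκ : HasCompactSupport κ)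
    (hf : HasCompactSupport f) {T : 𝓢'(Euc d, ℂ)} {h : Euc d → ℂ} (hT : IsGivenBy T h) :
    BandFubini κ f T := by
  set K := tsupport f - tsupport κ with hK
  have hKc : IsCompact K := isCompact_tsupport_sub hf hκ
  have hint : Integrable (K.indicator h) :=
    (integrable_indicator_iff hKc.measurableSet).2 (hT.1.integrableOn_isCompact hKc)
  have hprod : Integrable (fun p : Euc d × Euc d => κ (p.1 - p.2) * (f p.1 * K.indicator h p.2))
      (volume.prod volume) := by
    obtain ⟨C, hC⟩ := κ.decay 0 0
    refine (f.integrable.mul_prod hint).bdd_mul (c := C) ?_ (Eventually.of_forall fun p => ?_)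
    · exact (κ.continuous.comp (by fun_prop)).aestronglyMeasurable
    · simpa using hC.2 (p.1 - p.2)
  have heq : ∀ ξ η, κ (ξ - η) * (f ξ * K.indicator h η) = f ξ * (reflectShift κ ξ η * h η) := by
    intro ξ η
    rw [reflectShift_apply]
    by_cases hη : η ∈ K
    · rw [Set.indicator_of_mem hη]; ring
    · rw [Set.indicator_of_notMem hη]
      have : f ξ * κ (ξ - η) = 0 := by
        by_contra hne
        obtain ⟨h1, h2⟩ := mul_ne_zero_iff.1 hne
        exact hη (Set.mem_sub.2 ⟨ξ, subset_tsupport _ h1, _, subset_tsupport _ h2, by abel⟩)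
      linear_combination (-h η) * this
  have hval : ∀ ξ, f ξ * T (reflectShift κ ξ) = ∫ η, κ (ξ - η) * (f ξ * K.indicator h η) := by
    intro ξ
    rw [hT.2 _ (hasCompactSupport_reflectShift hκ ξ), ← integral_const_mul]
    simp only [heq]
  refine ⟨?_, ?_⟩
  · simp only [hval]
    exact hprod.integral_prod_left
  · simp only [hval]
    rw [hT.2 _ (hasCompactSupport_bandConv hκ hf), integral_integral_swap hprod]
    congr 1
    ext η
    rw [bandConv_apply, ← integral_mul_const]
    simp only [heq, reflectShift_apply, mul_assoc]

/-- For a piece known only in physical space, `ξ ↦ T (reflectShift κ ξ)` is the Fourier transform of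
`𝓕⁻ κ · g`, which is integrable because the two weights cancel. The interchange is then the
multiplication formula. -/
theorem BandFubini.of_fourier {d : ℕ} (κ f : 𝓢(Euc d, ℂ)) {T : 𝓢'(Euc d, ℂ)} {g : Euc d → ℂ}
    (hg : MemLp (fun x => (quadWeight x : ℂ)⁻¹ * g x) 2 volume)
    (hT : ∀ p : 𝓢(Euc d, ℂ), T p = ∫ x, 𝓕 p x * g x) : BandFubini κ f T := by
  have hint : Integrable (fun x => 𝓕⁻ κ x * g x) := by
    have h := (memLp_quadWeight_mul (𝓕⁻ κ : 𝓢(Euc d, ℂ))).integrable_mul hg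
    refine h.congr (Eventually.of_forall fun x => ?_)
    have : (quadWeight x : ℂ) ≠ 0 := by exact_mod_cast (quadWeight_pos x).ne'
    simp only [Pi.mul_apply]
    field_simp
  have hval : ∀ ξ, T (reflectShift κ ξ) = 𝓕 (fun x => 𝓕⁻ κ x * g x) ξ := by
    intro ξ
    rw [hT, Real.fourier_eq]
    congr 1
    ext x
    rw [fourier_reflectShift, Circle.smul_def, smul_eq_mul, mul_assoc]
  have hc : Continuous (𝓕 (fun x => 𝓕⁻ κ x * g x)) :=
    VectorFourier.fourierIntegral_continuous Real.continuous_fourierChar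
      (L := innerₗ (Euc d)) continuous_inner hint
  refine ⟨?_, ?_⟩
  · simp only [hval, mul_comm (f _)]
    refine f.integrable.bdd_mul (c := ∫ x, ‖𝓕⁻ κ x * g x‖) hc.aestronglyMeasurable
      (Eventually.of_forall fun ξ => ?_)
    exact VectorFourier.norm_fourierIntegral_le_integral_norm _ _ _ _ _
  · simp only [hval]
    have h := VectorFourier.integral_fourierIntegral_smul_eq_flip (μ := volume) (ν := volume)
      (L := innerₗ (Euc d)) Real.continuous_fourierChar continuous_inner f.integrable hint
    rw [hT]
    simp only [fourier_bandConv_apply, smul_eq_mul] at h ⊢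
    rw [flip_innerₗ] at h
    refine Eq.trans ?_ h
    congr 1
    ext x
    rw [mul_assoc, mul_left_comm]
    rfl

theorem BandFubini.add {d : ℕ} {κ f : 𝓢(Euc d, ℂ)} {S T : 𝓢'(Euc d, ℂ)} (hS : BandFubini κ f S)
    (hT : BandFubini κ f T) : BandFubini κ f (S + T) := by
  have h : ∀ p, (S + T) p = S p + T p := fun _ => rfl
  refine ⟨?_, ?_⟩
  · simp only [h, mul_add]
    exact hS.1.add hT.1
  · simp only [h, mul_add]
    rw [integral_add hS.1 hT.1, hS.2, hT.2]

theorem BandFubini.sum {d : ℕ} {κ f : 𝓢(Euc d, ℂ)} {ι : Type*} {T : ι → 𝓢'(Euc d, ℂ)}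
    (s : Finset ι) (hT : ∀ i ∈ s, BandFubini κ f (T i)) : BandFubini κ f (∑ i ∈ s, T i) := by
  classical
  induction s using Finset.induction_on with
  | empty =>
    have h : ∀ p, (0 : 𝓢'(Euc d, ℂ)) p = 0 := fun _ => rfl
    refine ⟨?_, ?_⟩ <;> simp [h]
  | insert i s hi ih =>
    rw [Finset.sum_insert hi]
    exact (hT i (Finset.mem_insert_self i s)).add
      (ih fun j hj => hT j (Finset.mem_insert_of_mem hj))

/-- All test functions involved live on the compact set `tsupport f - tsupport κ`, where `û` is a
finite sum of pieces of the two kinds already treated. -/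
theorem bandFubini_fourier {d : ℕ} {φ : 𝓢(Euc d, ℂ)}
    (hφ_supp : tsupport φ ⊆ Metric.closedBall 0 2)
    (hφ_one : ∀ ξ : Euc d, ‖ξ‖ ≤ 1 → φ ξ = 1) {lam : ℝ} (hlam : 1 < lam) {u : 𝓢'(Euc d, ℂ)}
    (hu : yStarSq φ lam u < ⊤) {κ f : 𝓢(Euc d, ℂ)} (hκ : HasCompactSupport κ)
    (hf : HasCompactSupport f) : BandFubini κ f (𝓕 u) := by
  have hKc : IsCompact (tsupport f - tsupport κ) := isCompact_tsupport_sub hf hκ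
  obtain ⟨n, -, hn⟩ := exists_zpow_bound hKc (critScale lam - 3) 0
  set S : 𝓢'(Euc d, ℂ) := 𝓕 (lpProjLe φ (critScale lam - 3) u) +
    ∑ i ∈ Finset.range n, 𝓕 (lpProj φ (critScale lam - 3 + 1 + i) u) with hS
  have hSu : ∀ p : 𝓢(Euc d, ℂ), (∀ η, p η ≠ 0 → η ∈ tsupport f - tsupport κ) → 𝓕 u p = S p := by
    intro p hp
    rw [fourier_apply_eq_add_sum hφ_one u p _ n fun ξ hξ => hn ξ (hp ξ hξ)]
    rw [hS]
    simp
  have hSF : BandFubini κ f S := by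
    obtain ⟨h₀, hh₀, -⟩ := exists_isGivenBy_low hφ_supp hu
    refine (BandFubini.of_isGivenBy hκ hf hh₀).add (.sum _ fun i _ => ?_)
    -- The indices `0, 1, 2, 3` are the critical scales `critScale lam - 2, …, critScale lam + 1`.
    by_cases hi : i < 4
    · obtain ⟨g, -, -, hg, hT⟩ := exists_isGivenBy_mid φ hlam hu
        (k := critScale lam - 3 + 1 + i) (by rw [Finset.mem_Icc]; lia)
      exact .of_fourier κ f hg hT
    · obtain ⟨h, hh, -⟩ := exists_isGivenBy_high hφ_supp hφ_one hu
        (k := critScale lam - 3 + 1 + i) (by rw [Set.mem_Ioi]; lia)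
      exact .of_isGivenBy hκ hf hh
  have hval : ∀ ξ, f ξ * 𝓕 u (reflectShift κ ξ) = f ξ * S (reflectShift κ ξ) := by
    intro ξ
    by_cases hξ : f ξ = 0
    · rw [hξ, zero_mul, zero_mul]
    · rw [hSu _ fun η hη => ?_]
      rw [reflectShift_apply] at hη
      exact Set.mem_sub.2 ⟨ξ, subset_tsupport _ hξ, _, subset_tsupport _ hη, by abel⟩
  refine ⟨by simpa only [hval] using hSF.1, ?_⟩
  simp only [hval]
  rw [hSu _ fun η hη => bandConv_support_subset κ f hη, hSF.2]

/-! ### A compactness criterion -/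

theorem memLp_indicator_comp_finset {α : Type*} [MeasurableSpace α] [MeasurableSingletonClass α]
    {β : Type*} [MeasurableSpace β]
    {μ : Measure β} {A : Set β} (hA : MeasurableSet A) (hμA : μ A < ⊤) {t : Finset α}
    {a : β → t} (ha : Measurable a) (c : t → ℂ) : MemLp (A.indicator (c ∘ a)) 2 μ := by
  rw [memLp_indicator_iff_restrict hA]
  have : IsFiniteMeasure (μ.restrict A) := ⟨by simpa using hμA⟩
  refine MemLp.of_bound ?_ ‖c‖ (Eventually.of_forall fun x => norm_le_pi_norm c (a x))
  exact ((measurable_of_countable c).comp ha).aestronglyMeasurable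

/-- The linear map that extends a function on a finite set to a function that is constant on the
cells of a finite partition of `A`. -/
def stepLp {α : Type*} [MeasurableSpace α] [MeasurableSingletonClass α]
    {β : Type*} [MeasurableSpace β]
    {μ : Measure β} {A : Set β} (hA : MeasurableSet A) (hμA : μ A < ⊤) {t : Finset α}
    {a : β → t} (ha : Measurable a) : (t → ℂ) →ₗ[ℂ] Lp ℂ 2 μ where
  toFun c := (memLp_indicator_comp_finset hA hμA ha c).toLp _
  map_add' c c' := by
    rw [← MemLp.toLp_add]
    congr 1
    exact Set.indicator_add A (c ∘ a) (c' ∘ a)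
  map_smul' z c := by
    rw [RingHom.id_apply, ← MemLp.toLp_const_smul]
    congr 1
    exact Set.indicator_const_smul A z (c ∘ a)

/-- Finitely many points of a dense sequence form an `η`-net of `A`, and the nearest of them can be
chosen measurably. -/
theorem exists_simpleFunc_dist_lt {X : Type*} [PseudoMetricSpace X] [SecondCountableTopology X]
    [Nonempty X] [MeasurableSpace X] [OpensMeasurableSpace X] {A : Set X} (hA : IsCompact A)
    {η : ℝ} (hη : 0 < η) : ∃ a : SimpleFunc X X, ∀ x ∈ A, dist (a x) x < η := by
  let e := TopologicalSpace.denseSeq X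
  obtain ⟨t, ht⟩ := hA.elim_finite_subcover (fun n : ℕ => Metric.ball (e n) η)
    (fun n => Metric.isOpen_ball) fun x _ => by
      obtain ⟨n, hn⟩ := (TopologicalSpace.denseRange_denseSeq X).exists_dist_lt x hη
      exact Set.mem_iUnion.2 ⟨n, hn⟩
  refine ⟨SimpleFunc.nearestPt e (t.sup id), fun x hx => ?_⟩
  obtain ⟨n, hn, hxn⟩ := Set.mem_iUnion₂.1 (ht hx)
  have h1 : n ≤ t.sup id := Finset.le_sup (f := id) hn
  have h2 := SimpleFunc.edist_nearestPt_le e x h1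
  rw [edist_dist, edist_dist] at h2
  refine ((ENNReal.ofReal_le_ofReal_iff dist_nonneg).1 h2).trans_lt ?_
  rw [dist_comm]
  exact hxn

/-- An operator into an `L²` space is compact if it is given by functions that are bounded and
Lipschitz, and whose `L²` norms are uniformly small outside of large balls. -/
theorem isCompactOperator_of_tail {Y : Type*} [SeminormedAddCommGroup Y] [NormedSpace ℂ Y] {d : ℕ}
    {μ : Measure (Euc d)} [IsFiniteMeasureOnCompacts μ] (G : Y →ₗ[ℂ] (Euc d → ℂ)) {C : ℝ}
    (hC : 0 ≤ C) (hb : ∀ u ξ, ‖G u ξ‖ ≤ C * ‖u‖)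
    (hl : ∀ u ξ η, ‖G u ξ - G u η‖ ≤ C * ‖u‖ * ‖ξ - η‖)
    (htail : ∀ ε > 0, ∃ M, ∀ u, eLpNorm ((Metric.closedBall (0 : Euc d) M)ᶜ.indicator (G u)) 2 μ ≤
      ENNReal.ofReal (ε * ‖u‖))
    (S : Y →L[ℂ] Lp ℂ 2 μ) (hS : ∀ u, S u =ᵐ[μ] G u) : IsCompactOperator S := by
  -- Compact operators form a closed set in operator norm, so it suffices to approximate `S` by
  -- operators of finite rank.
  have hclosed := isClosed_setOfPred_isCompactOperator (σ₁₂ := RingHom.id ℂ) (M₁ := Y)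
    (M₂ := Lp ℂ 2 μ)
  refine (hclosed.closure_subset_iff.2 subset_rfl) (Metric.mem_closure_iff.2 fun ε hε => ?_)
  obtain ⟨M, hM⟩ := htail (ε / 4) (by positivity)
  set A := Metric.closedBall (0 : Euc d) M with hA
  have hAc : IsCompact A := isCompact_closedBall 0 M
  have hAm : MeasurableSet A := hAc.measurableSet
  have hμA : μ A < ⊤ := hAc.measure_lt_top
  set m : ℝ := ((μ A) ^ (1 / 2 : ℝ)).toReal with hm
  have hm0 : 0 ≤ m := ENNReal.toReal_nonneg
  -- Chosen so that `C * η * m ≤ ε / 4`, where `m` is the square root of the measure of `A`; the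
  -- added ones keep the denominator positive.
  set η : ℝ := ε / (4 * (C + 1) * (m + 1)) with hη
  have hη0 : 0 < η := by positivity
  obtain ⟨a, ha⟩ := exists_simpleFunc_dist_lt hAc hη0
  let a' : Euc d → a.range := fun x => ⟨a x, a.mem_range_self x⟩
  have ha' : Measurable a' := a.measurable.subtype_mk
  -- The approximation samples `G u` at the finitely many values of `a`, and `L` turns the samples
  -- into a step function on `A`.
  let ev : Y →L[ℂ] (a.range → ℂ) := LinearMap.mkContinuous
    ((LinearMap.funLeft ℂ ℂ (Subtype.val : a.range → Euc d)).comp G) C fun u => by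
      refine (pi_norm_le_iff_of_nonneg (by positivity)).2 fun y => hb u y
  let L : (a.range → ℂ) →L[ℂ] Lp ℂ 2 μ := (stepLp hAm hμA ha').toContinuousLinearMap
  have hev : IsCompactOperator ev := isCompactOperator_of_locallyCompactSpace_dom ev
  refine ⟨L.comp ev, hev.clm_comp L, ?_⟩
  have hbound : ∀ u, ‖(S - L.comp ev) u‖ ≤ ε / 2 * ‖u‖ := by
    intro u
    have h1 : (L.comp ev) u =ᵐ[μ] A.indicator (fun x => G u (a x)) :=
      (memLp_indicator_comp_finset hAm hμA ha' (ev u)).coeFn_toLp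
    -- The error is the tail outside `A` plus the oscillation of `G u` at distance less than `η`
    -- inside `A`; each costs `ε / 4`.
    have h2 : ((S - L.comp ev) u : Lp ℂ 2 μ) =ᵐ[μ]
        Aᶜ.indicator (G u) + A.indicator (fun x => G u x - G u (a x)) := by
      rw [_root_.sub_apply]
      filter_upwards [Lp.coeFn_sub (S u) ((L.comp ev) u), hS u, h1] with x hx1 hx2 hx3
      rw [hx1, Pi.sub_apply, hx2, hx3, Pi.add_apply]
      by_cases hx : x ∈ A
      · simp [hx]
      · simp [hx]
    have hGc : Continuous (G u) := by
      refine (LipschitzWith.of_dist_le_mul (K := ⟨C * ‖u‖, by positivity⟩) fun ξ η => ?_).continuous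
      rw [dist_eq_norm, dist_eq_norm]
      exact hl u ξ η
    have hm1 : AEStronglyMeasurable (Aᶜ.indicator (G u)) μ :=
      hGc.aestronglyMeasurable.indicator hAm.compl
    have hm2 : AEStronglyMeasurable (A.indicator (fun x => G u x - G u (a x))) μ :=
      (hGc.aestronglyMeasurable.sub
        (hGc.measurable.comp a.measurable).aestronglyMeasurable).indicator hAm
    have h3 : eLpNorm (A.indicator (fun x => G u x - G u (a x))) 2 μ ≤
        ENNReal.ofReal (C * ‖u‖ * η * m) := by
      rw [eLpNorm_indicator_eq_eLpNorm_restrict hAm]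
      have h4 : ∀ᵐ x ∂(μ.restrict A), ‖G u x - G u (a x)‖ ≤ C * ‖u‖ * η := by
        filter_upwards [ae_restrict_mem hAm] with x hx
        refine (hl u x (a x)).trans ?_
        gcongr
        rw [← dist_eq_norm, dist_comm]
        exact (ha x hx).le
      refine (eLpNorm_le_of_ae_bound h4).trans (le_of_eq ?_)
      rw [mul_comm, ENNReal.ofReal_mul (p := C * ‖u‖ * η) (by positivity), hm, ENNReal.ofReal_toReal]
      · simp
      · exact (ENNReal.rpow_lt_top_of_nonneg (by norm_num) hμA.ne).ne
    have h5 : C * ‖u‖ * η * m ≤ ε / 4 * ‖u‖ := by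
      have h6 : C * η * m ≤ ε / 4 := by
        rw [hη, mul_div_assoc', div_mul_eq_mul_div, div_le_div_iff₀ (by positivity) (by norm_num)]
        nlinarith [mul_nonneg hC hm0, mul_nonneg hε.le hC, mul_nonneg hε.le hm0]
      nlinarith [norm_nonneg u]
    rw [Lp.norm_def, eLpNorm_congr_ae h2]
    refine ENNReal.toReal_le_of_le_ofReal (by positivity) ?_
    refine (eLpNorm_add_le hm1 hm2 one_le_two).trans ?_
    refine (add_le_add (hM u) (h3.trans (ENNReal.ofReal_le_ofReal h5))).trans (le_of_eq ?_)
    rw [← ENNReal.ofReal_add (by positivity) (by positivity)]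
    congr 1
    ring
  rw [dist_eq_norm]
  exact (ContinuousLinearMap.opNorm_le_bound _ (by positivity) hbound).trans_lt (by linarith)

/-! ### Young's inequality -/

/-- Write `k H = k^(1/2) · (k^(1/2) H)`, apply Cauchy–Schwarz in `η`, and integrate in `ξ` by
Tonelli and translation invariance. -/
theorem lintegral_sq_conv_le {d : ℕ} {k H : Euc d → ℝ≥0∞} (hk : Measurable k)
    (hH : AEMeasurable H volume) :
    ∫⁻ ξ, (∫⁻ η, k (ξ - η) * H η) ^ 2 ≤ (∫⁻ ζ, k ζ) ^ 2 * ∫⁻ η, H η ^ 2 := by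
  have hkm : ∀ ξ : Euc d, Measurable fun η => k (ξ - η) := fun ξ => hk.comp (by fun_prop)
  have h1 : ∀ ξ, (∫⁻ η, k (ξ - η) * H η) ^ 2 ≤ (∫⁻ ζ, k ζ) * ∫⁻ η, k (ξ - η) * H η ^ 2 := by
    intro ξ
    have hsq : ∀ a : ℝ≥0∞, (a ^ (1 / 2 : ℝ)) ^ 2 = a := fun a => by
      rw [← ENNReal.rpow_natCast, ← ENNReal.rpow_mul]; norm_num
    have h2 := lintegral_mul_sq_le volume ((hkm ξ).pow_const (1 / 2 : ℝ)).aemeasurable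
      (((hkm ξ).pow_const (1 / 2 : ℝ)).aemeasurable.mul hH)
    simp only [Pi.mul_apply, mul_pow, hsq, ← mul_assoc, ← pow_two] at h2
    rwa [lintegral_sub_left_eq_self k ξ] at h2
  have h3 : AEMeasurable (fun p : Euc d × Euc d => k (p.1 - p.2) * H p.2 ^ 2)
      (volume.prod volume) :=
    (hk.comp (measurable_fst.sub measurable_snd)).aemeasurable.mul (hH.comp_snd.pow_const 2)
  calc _ ≤ ∫⁻ ξ, (∫⁻ ζ, k ζ) * ∫⁻ η, k (ξ - η) * H η ^ 2 := lintegral_mono h1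
    _ = (∫⁻ ζ, k ζ) * ∫⁻ ξ, ∫⁻ η, k (ξ - η) * H η ^ 2 :=
        lintegral_const_mul'' _ h3.lintegral_prod_right'
    _ = (∫⁻ ζ, k ζ) * ∫⁻ η, ∫⁻ ξ, k (ξ - η) * H η ^ 2 := by rw [lintegral_lintegral_swap h3]
    _ = (∫⁻ ζ, k ζ) * ∫⁻ η, (∫⁻ ζ, k ζ) * H η ^ 2 := by
        congr 2
        ext η
        rw [lintegral_mul_const (f := fun ξ => k (ξ - η)) _ (hk.comp (by fun_prop)),
          lintegral_sub_right_eq_self k η]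
    _ = _ := by
        rw [lintegral_const_mul'' _ (hH.pow_const 2), ← mul_assoc, pow_two]

/-- Lets the weight pass inside a convolution, one factor to each function. -/
theorem freqWeight_le_mul {d : ℕ} (ξ η : Euc d) :
    freqWeight ξ ≤ freqWeight (ξ - η) * freqWeight η := by
  have h1 : ‖ξ‖ ≤ ‖ξ - η‖ + ‖η‖ := by simpa using norm_add_le (ξ - η) η
  have h2 : 0 ≤ 2 * π * ‖ξ - η‖ := by positivity
  have h3 : 0 ≤ 2 * π * ‖η‖ := by positivity
  have h4 : 2 * π * ‖ξ‖ ≤ 2 * π * ‖ξ - η‖ + 2 * π * ‖η‖ := by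
    rw [← mul_add]; gcongr
  unfold freqWeight
  nlinarith

/-! ### The Fourier transform of the product -/

/-- The Fourier transform of `𝓕⁻ κ · u`. -/
def bandFourier {d : ℕ} (κ : 𝓢(Euc d, ℂ)) (u : 𝓢'(Euc d, ℂ)) (ξ : Euc d) : ℂ :=
  𝓕 u (reflectShift κ ξ)

theorem eLpNorm_le_quadWeight_fourier {d : ℕ} (p : 𝓢(Euc d, ℂ)) :
    eLpNorm p 2 volume ≤ eLpNorm (fun x => (quadWeight x : ℂ) * 𝓕 p x) 2 volume := by
  have h1 : eLpNorm p 2 volume = eLpNorm (𝓕 p : 𝓢(Euc d, ℂ)) 2 volume := by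
    have h := SchwartzMap.norm_fourier_toL2_eq p
    rw [SchwartzMap.norm_toLp, SchwartzMap.norm_toLp] at h
    have h2 : eLpNorm p 2 volume ≠ ⊤ := (p.memLp 2 volume).2.ne
    have h3 : eLpNorm (𝓕 p : 𝓢(Euc d, ℂ)) 2 volume ≠ ⊤ :=
      ((𝓕 p : 𝓢(Euc d, ℂ)).memLp 2 volume).2.ne
    rw [← ENNReal.ofReal_toReal h2, ← h, ENNReal.ofReal_toReal h3]
  rw [h1]
  refine eLpNorm_mono fun x => ?_
  rw [norm_mul, Complex.norm_real, Real.norm_eq_abs, abs_of_pos (quadWeight_pos x)]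
  refine le_mul_of_one_le_left (norm_nonneg _) ?_
  unfold quadWeight
  nlinarith [sq_nonneg ‖x‖]

/-- The majorant term is absorbed by Cauchy–Schwarz and Plancherel: `18 ≤ 5²`, and `21 = 5 + 16`. -/
theorem enorm_fourier_apply_le {d : ℕ} {φ : 𝓢(Euc d, ℂ)}
    (hφ_supp : tsupport φ ⊆ Metric.closedBall 0 2)
    (hφ_one : ∀ ξ : Euc d, ‖ξ‖ ≤ 1 → φ ξ = 1) {lam : ℝ} (hlam : 1 < lam) {u : 𝓢'(Euc d, ℂ)}
    (hu : yStarSq φ lam u < ⊤) {p : 𝓢(Euc d, ℂ)} (hp : HasCompactSupport p) :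
    ‖𝓕 u p‖ₑ ≤ 21 * yStarSq φ lam u ^ (1 / 2 : ℝ) *
      eLpNorm (fun x => (quadWeight x : ℂ) * 𝓕 p x) 2 volume := by
  obtain ⟨H, hHm, hHi, hH, -⟩ := exists_enorm_fourier_apply_le hφ_supp hφ_one hlam hu
  set b := yStarSq φ lam u ^ (1 / 2 : ℝ) with hb
  have hb2 : b ^ 2 = yStarSq φ lam u := by
    rw [hb, ← ENNReal.rpow_natCast, ← ENNReal.rpow_mul]; norm_num
  have h1 : ∫⁻ ξ, ‖p ξ‖ₑ * H ξ ≤ 5 * b * eLpNorm p 2 volume := by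
    rw [mul_comm (5 * b)]
    refine ENNReal.le_mul_of_sq_le_sq_mul_sq ?_
    refine (lintegral_mul_sq_le volume p.continuous.aestronglyMeasurable.enorm hHm).trans ?_
    rw [eLpNorm_two_sq]
    refine mul_le_mul_right ?_ _
    calc ∫⁻ ξ, H ξ ^ 2 ≤ ∫⁻ ξ, ENNReal.ofReal (freqWeight ξ) ^ 2 * H ξ ^ 2 := by
          refine lintegral_mono fun ξ => le_mul_of_one_le_left' ?_
          refine one_le_pow₀ ?_
          rw [← ENNReal.ofReal_one]
          exact ENNReal.ofReal_le_ofReal (one_le_freqWeight ξ)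
      _ ≤ 18 * b ^ 2 := by rw [hb2]; exact hHi
      _ ≤ (5 * b) ^ 2 := by
          rw [mul_pow]
          gcongr
          norm_num
  calc _ ≤ _ := hH p hp
    _ ≤ 5 * b * eLpNorm (fun x => (quadWeight x : ℂ) * 𝓕 p x) 2 volume +
        16 * b * eLpNorm (fun x => (quadWeight x : ℂ) * 𝓕 p x) 2 volume := by
        refine add_le_add (h1.trans ?_) le_rfl
        gcongr
        exact eLpNorm_le_quadWeight_fourier p
    _ = _ := by ring

theorem norm_fourierChar_sub_le (s t : ℝ) : ‖(𝐞 s : ℂ) - 𝐞 t‖ ≤ 2 * π * |s - t| := by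
  have h1 : (𝐞 s : ℂ) - 𝐞 t = 𝐞 t * (𝐞 (s - t) - 1) := by
    rw [mul_sub, mul_one, ← Circle.coe_mul, ← AddChar.map_add_eq_mul, add_sub_cancel]
  rw [h1, norm_mul, Circle.norm_coe, one_mul, Real.fourierChar_apply, mul_comm (Complex.ofReal _)]
  refine (Real.norm_exp_I_mul_ofReal_sub_one_le).trans (le_of_eq ?_)
  rw [Real.norm_eq_abs, abs_mul, abs_of_pos Real.two_pi_pos]

theorem eLpNorm_fourier_reflectShift {d : ℕ} (κ : 𝓢(Euc d, ℂ)) (ξ : Euc d) :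
    eLpNorm (fun x => (quadWeight x : ℂ) * 𝓕 (reflectShift κ ξ) x) 2 volume =
      eLpNorm (fun x => (quadWeight x : ℂ) * 𝓕⁻ κ x) 2 volume := by
  refine eLpNorm_congr_norm_ae (Eventually.of_forall fun x => ?_)
  rw [fourier_reflectShift, norm_mul, norm_mul, norm_mul, Circle.norm_coe, one_mul]

/-- The difference of two characters is at most `2π |x| |ξ - ξ'|`, and `|x| ≤ 1 + |x|²`; this is the
reason for the second factor of the weight. -/
theorem eLpNorm_fourier_reflectShift_sub {d : ℕ} (κ : 𝓢(Euc d, ℂ)) (ξ ξ' : Euc d) :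
    eLpNorm (fun x => (quadWeight x : ℂ) * 𝓕 (reflectShift κ ξ - reflectShift κ ξ') x) 2 volume ≤
      ENNReal.ofReal (2 * π * ‖ξ - ξ'‖) *
        eLpNorm (fun x => (quadWeight x : ℂ) * (quadWeight x * 𝓕⁻ κ x)) 2 volume := by
  refine eLpNorm_le_mul_eLpNorm_of_ae_le_mul (Eventually.of_forall fun x => ?_) 2
  have h1 : 𝓕 (reflectShift κ ξ - reflectShift κ ξ') x =
      ((𝐞 (-inner ℝ x ξ) : ℂ) - 𝐞 (-inner ℝ x ξ')) * 𝓕⁻ κ x := by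
    have : 𝓕 (reflectShift κ ξ - reflectShift κ ξ') =
        𝓕 (reflectShift κ ξ) - 𝓕 (reflectShift κ ξ') :=
      (fourierCLM ℂ 𝓢(Euc d, ℂ)).map_sub _ _
    rw [this, sub_apply, fourier_reflectShift, fourier_reflectShift, sub_mul]
  have h2 : |-inner ℝ x ξ - -inner ℝ x ξ'| ≤ ‖ξ - ξ'‖ * quadWeight x := by
    rw [neg_sub_neg, ← inner_sub_right, norm_sub_rev ξ ξ']
    refine (abs_real_inner_le_norm _ _).trans ?_
    rw [mul_comm]
    gcongr
    unfold quadWeight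
    nlinarith [sq_nonneg (‖x‖ - 1), norm_nonneg x]
  have hq := quadWeight_pos x
  rw [h1, norm_mul, norm_mul, norm_mul, norm_mul, Complex.norm_real, Real.norm_eq_abs,
    abs_of_pos hq]
  calc _ ≤ quadWeight x * (2 * π * (‖ξ - ξ'‖ * quadWeight x) * ‖𝓕⁻ κ x‖) := by
        gcongr
        exact (norm_fourierChar_sub_le _ _).trans (by gcongr)
    _ = _ := by ring

theorem exists_bandFourier_bounds {d : ℕ} {φ : 𝓢(Euc d, ℂ)}
    (hφ_supp : tsupport φ ⊆ Metric.closedBall 0 2)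
    (hφ_one : ∀ ξ : Euc d, ‖ξ‖ ≤ 1 → φ ξ = 1) {lam : ℝ} (hlam : 1 < lam)
    {κ : 𝓢(Euc d, ℂ)} (hκ : HasCompactSupport κ) :
    ∃ C : ℝ, 0 ≤ C ∧ ∀ u : YStar φ lam,
      (∀ ξ, ‖bandFourier κ ((yStarSeminorm φ lam).incl u) ξ‖ ≤ C * ‖u‖) ∧
      ∀ ξ ξ', ‖bandFourier κ ((yStarSeminorm φ lam).incl u) ξ -
        bandFourier κ ((yStarSeminorm φ lam).incl u) ξ'‖ ≤ C * ‖u‖ * ‖ξ - ξ'‖ := by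
  set A := eLpNorm (fun x => (quadWeight x : ℂ) * 𝓕⁻ κ x) 2 volume with hA
  set B := eLpNorm (fun x => (quadWeight x : ℂ) * (quadWeight x * 𝓕⁻ κ x)) 2 volume with hB
  have hAt : A < ⊤ := (memLp_quadWeight_mul (𝓕⁻ κ : 𝓢(Euc d, ℂ))).2
  have hBt : B < ⊤ := by
    have h := (memLp_quadWeight_mul (SchwartzMap.smulLeftCLM ℂ
      (fun x : Euc d => (quadWeight x : ℂ)) (𝓕⁻ κ : 𝓢(Euc d, ℂ)))).2
    simpa only [SchwartzMap.smulLeftCLM_apply_apply hasTemperateGrowth_quadWeight,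
      smul_eq_mul] using h
  -- The first summand serves the uniform bound, the second the Lipschitz bound.
  refine ⟨21 * A.toReal + 21 * (2 * π) * B.toReal, by positivity, fun u => ?_⟩
  set b := yStarSq φ lam ((yStarSeminorm φ lam).incl u) ^ (1 / 2 : ℝ) with hb
  have hbt : b < ⊤ := u.2
  have hu : yStarSq φ lam ((yStarSeminorm φ lam).incl u) < ⊤ := by
    refine lt_top_iff_ne_top.2 fun h => ?_
    rw [hb, h, ENNReal.top_rpow_of_pos (by norm_num)] at hbt
    exact lt_irrefl _ hbt
  have hnorm : ‖u‖ = b.toReal := rfl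
  refine ⟨fun ξ => ?_, fun ξ ξ' => ?_⟩
  · have h := enorm_fourier_apply_le hφ_supp hφ_one hlam hu (hasCompactSupport_reflectShift hκ ξ)
    rw [eLpNorm_fourier_reflectShift, ← hb, ← hA] at h
    have h2 := ENNReal.toReal_mono (by finiteness) h
    rw [toReal_enorm, ENNReal.toReal_mul, ENNReal.toReal_mul, ← hnorm] at h2
    refine h2.trans ?_
    have : 0 ≤ 21 * (2 * π) * B.toReal * ‖u‖ := by positivity
    norm_num
    linarith
  · have hc : HasCompactSupport (reflectShift κ ξ - reflectShift κ ξ' : 𝓢(Euc d, ℂ)) := by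
      have : ((reflectShift κ ξ - reflectShift κ ξ' : 𝓢(Euc d, ℂ)) : Euc d → ℂ) =
          reflectShift κ ξ - reflectShift κ ξ' := by ext; simp
      rw [this]
      exact (hasCompactSupport_reflectShift hκ ξ).sub (hasCompactSupport_reflectShift hκ ξ')
    have h := (enorm_fourier_apply_le hφ_supp hφ_one hlam hu hc).trans
      (mul_le_mul_right (eLpNorm_fourier_reflectShift_sub κ ξ ξ') _)
    rw [← hb, ← hB, _root_.map_sub] at h
    have h2 := ENNReal.toReal_mono (by finiteness) h
    rw [toReal_enorm, ENNReal.toReal_mul, ENNReal.toReal_mul, ENNReal.toReal_mul, ← hnorm,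
      ENNReal.toReal_ofReal (by positivity)] at h2
    refine h2.trans ?_
    have : 0 ≤ 21 * A.toReal * ‖u‖ * ‖ξ - ξ'‖ := by positivity
    norm_num
    linarith

/-- On a large ball `E` the uniform bound suffices, because the volume is finite. Off `E`, the
function `κ(ξ - ·)` lives beyond the critical frequencies, so only the majorant `H` is felt, and the
weighted convolution is handled by `freqWeight_le_mul` and Young's inequality. -/
theorem exists_lintegral_bandFourier_le {d : ℕ} {φ : 𝓢(Euc d, ℂ)}
    (hφ_supp : tsupport φ ⊆ Metric.closedBall 0 2)
    (hφ_one : ∀ ξ : Euc d, ‖ξ‖ ≤ 1 → φ ξ = 1) {lam : ℝ} (hlam : 1 < lam)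
    {κ : 𝓢(Euc d, ℂ)} (hκ : HasCompactSupport κ) :
    ∃ C : ℝ≥0∞, C < ⊤ ∧ ∀ u : 𝓢'(Euc d, ℂ), yStarSq φ lam u < ⊤ →
      ∫⁻ ξ, ENNReal.ofReal (freqWeight ξ) ^ 2 * ‖bandFourier κ u ξ‖ₑ ^ 2 ≤
        C * yStarSq φ lam u := by
  obtain ⟨ρ, hρ⟩ := (HasCompactSupport.isCompact hκ).isBounded.exists_norm_le
  -- The end of the critical frequencies, enlarged by the radius `ρ` of a ball containing the
  -- support of `κ`.
  set M : ℝ := (2 : ℝ) ^ (critScale lam + 2) + 2 * π * ρ with hM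
  set E : Set (Euc d) := {ξ | 2 * π * ‖ξ‖ ≤ M} with hE
  have hEm : MeasurableSet E := measurableSet_le (measurable_norm.const_mul _) measurable_const
  have hEv : volume E < ⊤ := by
    refine (measure_mono (t := Metric.closedBall (0 : Euc d) (M / (2 * π))) fun ξ hξ => ?_).trans_lt
      (isCompact_closedBall _ _).measure_lt_top
    rw [mem_closedBall_zero_iff, le_div_iff₀' Real.two_pi_pos]
    exact hξ
  set A := eLpNorm (fun x => (quadWeight x : ℂ) * 𝓕⁻ κ x) 2 volume with hA
  have hAt : A < ⊤ := (memLp_quadWeight_mul (𝓕⁻ κ : 𝓢(Euc d, ℂ))).2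
  set k : Euc d → ℝ≥0∞ := fun ζ => ENNReal.ofReal (freqWeight ζ) * ‖κ ζ‖ₑ with hk
  have hkm : Measurable k :=
    continuous_freqWeight.measurable.ennreal_ofReal.mul κ.continuous.measurable.enorm
  have hkt : ∫⁻ ζ, k ζ < ⊤ := by
    have hint : Integrable (fun ζ => (freqWeight ζ : ℂ) * κ ζ) := by
      refine Continuous.integrable_of_hasCompactSupport ?_ hκ.mul_left
      exact (Complex.continuous_ofReal.comp continuous_freqWeight).mul κ.continuous
    refine lt_of_eq_of_lt ?_ hint.2
    congr 1
    ext ζ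
    rw [hk, enorm_mul, ← ofReal_norm (freqWeight ζ : ℂ), Complex.norm_real, Real.norm_eq_abs,
      abs_of_pos (zero_lt_one.trans_le (one_le_freqWeight ζ))]
  refine ⟨2 * ((∫⁻ ζ, k ζ) ^ 2 * 18) + 2 * ((ENNReal.ofReal (1 + M) * (21 * A)) ^ 2 * volume E),
    by finiteness, fun u hu => ?_⟩
  obtain ⟨H, hHm, hHi, -, hH⟩ := exists_enorm_fourier_apply_le hφ_supp hφ_one hlam hu
  set b := yStarSq φ lam u ^ (1 / 2 : ℝ) with hb
  have hb2 : b ^ 2 = yStarSq φ lam u := by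
    rw [hb, ← ENNReal.rpow_natCast, ← ENNReal.rpow_mul]; norm_num
  set W : Euc d → ℝ≥0∞ := fun ξ => ENNReal.ofReal (freqWeight ξ) with hW
  set c : ℝ≥0∞ := ENNReal.ofReal (1 + M) * (21 * A) * b with hc
  have hWm : AEMeasurable (fun η => W η * H η) volume :=
    continuous_freqWeight.measurable.ennreal_ofReal.aemeasurable.mul hHm
  have hpt : ∀ ξ, W ξ * ‖bandFourier κ u ξ‖ₑ ≤
      (∫⁻ η, k (ξ - η) * (W η * H η)) + E.indicator (fun _ => c) ξ := by
    intro ξ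
    by_cases hξ : ξ ∈ E
    · rw [Set.indicator_of_mem hξ]
      refine le_add_left ?_
      have h := enorm_fourier_apply_le hφ_supp hφ_one hlam hu
        (hasCompactSupport_reflectShift hκ ξ)
      rw [eLpNorm_fourier_reflectShift, ← hb, ← hA] at h
      calc _ ≤ ENNReal.ofReal (1 + M) * (21 * b * A) := by
            refine mul_le_mul' (ENNReal.ofReal_le_ofReal ?_) h
            unfold freqWeight
            have : 2 * π * ‖ξ‖ ≤ M := hξ
            linarith
        _ = c := by rw [hc]; ring
    · refine le_add_right ?_
      have h := hH _ (hasCompactSupport_reflectShift hκ ξ) fun η hη => by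
        rw [reflectShift_apply] at hη
        have h1 := hρ _ (subset_tsupport _ hη)
        have h2 : ‖ξ‖ ≤ ‖ξ - η‖ + ‖η‖ := by simpa using norm_add_le (ξ - η) η
        have h3 : M < 2 * π * ‖ξ‖ := not_le.1 hξ
        have h4 : 2 * π * ‖ξ‖ ≤ 2 * π * ρ + 2 * π * ‖η‖ := by
          rw [← mul_add]; gcongr; linarith
        linarith
      calc _ ≤ W ξ * ∫⁻ η, ‖reflectShift κ ξ η‖ₑ * H η := mul_le_mul_right h _
        _ = ∫⁻ η, W ξ * (‖κ (ξ - η)‖ₑ * H η) := by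
            rw [← lintegral_const_mul' _ _ ENNReal.ofReal_ne_top]
            simp only [reflectShift_apply, hW]
        _ ≤ _ := by
            refine lintegral_mono fun η => ?_
            have h5 : W ξ ≤ W (ξ - η) * W η := by
              rw [hW]
              simp only
              rw [← ENNReal.ofReal_mul (zero_le_one.trans (one_le_freqWeight _))]
              exact ENNReal.ofReal_le_ofReal (freqWeight_le_mul ξ η)
            calc _ ≤ W (ξ - η) * W η * (‖κ (ξ - η)‖ₑ * H η) := mul_le_mul_left h5 _
              _ = _ := by rw [hk]; ring
  have h6 : ∀ x y : ℝ≥0∞, (x + y) ^ 2 ≤ 2 * x ^ 2 + 2 * y ^ 2 := fun x y => by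
    have := ENNReal.rpow_add_le_mul_rpow_add_rpow x y (p := 2) one_le_two
    norm_num at this
    rwa [mul_add] at this
  calc _ ≤ ∫⁻ ξ, (2 * (∫⁻ η, k (ξ - η) * (W η * H η)) ^ 2 +
        E.indicator (fun _ => 2 * c ^ 2) ξ) := by
        refine lintegral_mono fun ξ => ?_
        rw [← mul_pow]
        refine (pow_le_pow_left' (hpt ξ) 2).trans ((h6 _ _).trans (le_of_eq ?_))
        by_cases hξ : ξ ∈ E
        · rw [Set.indicator_of_mem hξ, Set.indicator_of_mem hξ]
        · rw [Set.indicator_of_notMem hξ, Set.indicator_of_notMem hξ]; simp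
    _ = 2 * (∫⁻ ξ, (∫⁻ η, k (ξ - η) * (W η * H η)) ^ 2) + 2 * c ^ 2 * volume E := by
        rw [lintegral_add_right _ (measurable_const.indicator hEm),
          lintegral_const_mul' _ _ (by norm_num), lintegral_indicator_const hEm]
    _ ≤ 2 * ((∫⁻ ζ, k ζ) ^ 2 * (18 * yStarSq φ lam u)) + 2 * c ^ 2 * volume E := by
        gcongr
        refine (lintegral_sq_conv_le hkm hWm).trans ?_
        gcongr
        simpa only [mul_pow] using hHi
    _ = _ := by
        rw [hc, mul_pow _ b, hb2]
        ring

/-! ### A weighted `L²` space and its map to the Besov space -/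

/-- The continuous linear map to a space of vectors of finite extended seminorm induced by a linear
map that is bounded for the seminorm. -/
def ExtSeminorm.lift {V X : Type*} [AddCommGroup V] [Module ℂ V] [SeminormedAddCommGroup X]
    [NormedSpace ℂ X] (p : ExtSeminorm V) (A : X →ₗ[ℂ] V) (K : ℝ)
    (h : ∀ x, p.toFun (A x) ≤ ENNReal.ofReal (K * ‖x‖)) : X →L[ℂ] p.Space :=
  LinearMap.mkContinuous
    (A.codRestrict p.finite fun x => (h x).trans_lt ENNReal.ofReal_lt_top : X →ₗ[ℂ] p.finite)
    (max K 0) fun x => by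
      refine ENNReal.toReal_le_of_le_ofReal (by positivity) ((h x).trans ?_)
      exact ENNReal.ofReal_le_ofReal (by gcongr; exact le_max_left _ _)

/-- The density `(1 + |2πξ|)^(3/2)`. -/
def sobDensity {d : ℕ} (ξ : Euc d) : ℝ := freqWeight ξ * √(freqWeight ξ)

theorem continuous_sobDensity {d : ℕ} : Continuous (sobDensity (d := d)) :=
  continuous_freqWeight.mul continuous_freqWeight.sqrt

theorem one_le_sobDensity {d : ℕ} (ξ : Euc d) : 1 ≤ sobDensity ξ :=
  one_le_mul_of_one_le_of_one_le (one_le_freqWeight ξ) (Real.one_le_sqrt.2 (one_le_freqWeight ξ))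

/-- The measure for which the Fourier transform of the Sobolev space of order `3/4` is the space
of square integrable functions. -/
def sobMeasure (d : ℕ) : Measure (Euc d) :=
  volume.withDensity fun ξ => ENNReal.ofReal (sobDensity ξ)

instance (d : ℕ) : IsLocallyFiniteMeasure (sobMeasure d) :=
  IsLocallyFiniteMeasure.withDensity_ofReal continuous_sobDensity

theorem volume_le_sobMeasure (d : ℕ) : volume ≤ sobMeasure d := by
  conv_lhs => rw [← withDensity_one (μ := (volume : Measure (Euc d)))]
  refine withDensity_mono (Eventually.of_forall fun ξ => ?_)
  rw [Pi.one_apply, ← ENNReal.ofReal_one]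
  exact ENNReal.ofReal_le_ofReal (one_le_sobDensity ξ)

theorem eLpNorm_sobMeasure_sq {d : ℕ} {g : Euc d → ℂ} (hg : AEStronglyMeasurable g volume) :
    eLpNorm g 2 (sobMeasure d) ^ 2 = ∫⁻ ξ, ENNReal.ofReal (sobDensity ξ) * ‖g ξ‖ₑ ^ 2 := by
  rw [eLpNorm_two_sq, sobMeasure, lintegral_withDensity_eq_lintegral_mul₀
    continuous_sobDensity.measurable.ennreal_ofReal.aemeasurable (hg.enorm.pow_const 2)]
  rfl

theorem memLp_volume_of_sobMeasure {d : ℕ} (q : Lp ℂ 2 (sobMeasure d)) : MemLp q 2 volume :=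
  (Lp.memLp q).mono_measure (volume_le_sobMeasure d)

/-- The inclusion of the weighted space in `L²`. -/
def sobToLp (d : ℕ) : Lp ℂ 2 (sobMeasure d) →ₗ[ℂ] Lp (α := Euc d) ℂ 2 volume where
  toFun q := (memLp_volume_of_sobMeasure q).toLp q
  map_add' p q := by
    rw [← MemLp.toLp_add]
    exact MemLp.toLp_congr _ _
      ((volume_le_sobMeasure d).absolutelyContinuous.ae_le (Lp.coeFn_add p q))
  map_smul' c q := by
    rw [RingHom.id_apply, ← MemLp.toLp_const_smul]
    exact MemLp.toLp_congr _ _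
      ((volume_le_sobMeasure d).absolutelyContinuous.ae_le (Lp.coeFn_smul c q))

/-- The inverse Fourier transform on the weighted space. -/
def sobFourierInv (d : ℕ) : Lp ℂ 2 (sobMeasure d) →ₗ[ℂ] 𝓢'(Euc d, ℂ) :=
  ((fourierInvCLM ℂ 𝓢'(Euc d, ℂ)).toLinearMap ∘ₗ
    (Lp.toTemperedDistributionCLM ℂ volume 2).toLinearMap) ∘ₗ sobToLp d

theorem sobFourierInv_apply {d : ℕ} (q : Lp ℂ 2 (sobMeasure d)) :
    sobFourierInv d q = 𝓕⁻ (Lp.toTemperedDistribution (sobToLp d q) : 𝓢'(Euc d, ℂ)) := rfl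

theorem isGivenBy_toTemperedDistribution {d : ℕ} (f : Lp (α := Euc d) ℂ 2 volume) :
    IsGivenBy (Lp.toTemperedDistribution f) f :=
  ⟨(Lp.memLp f).locallyIntegrable one_le_two, fun p _ => by
    rw [Lp.toTemperedDistribution_apply]; rfl⟩

theorem norm_lpSymb_le {d : ℕ} (φ : 𝓢(Euc d, ℂ)) (l : ℤ) (ξ : Euc d) :
    ‖lpSymb φ l ξ‖ ≤ 2 * SchwartzMap.seminorm ℝ 0 0 φ := by
  rw [lpSymb_eq_sub, two_mul]
  exact (norm_sub_le _ _).trans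
    (add_le_add (φ.norm_le_seminorm ℝ _) (φ.norm_le_seminorm ℝ _))

theorem continuous_lpSymb {d : ℕ} (φ : 𝓢(Euc d, ℂ)) (l : ℤ) : Continuous (lpSymb φ l) :=
  (hasTemperateGrowth_lpSymb φ l).1.continuous

/-- Plancherel, with the bounded symbol acting on `L²` by multiplication. -/
theorem distNorm_lpProj_fourierInv {d : ℕ} (φ : 𝓢(Euc d, ℂ)) (l : ℤ)
    (f : Lp (α := Euc d) ℂ 2 volume) :
    distNorm normL2 (lpProj φ l (𝓕⁻ (Lp.toTemperedDistribution f : 𝓢'(Euc d, ℂ)))) =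
      eLpNorm (fun ξ => lpSymb φ l ξ * f ξ) 2 volume := by
  have hm : MemLp (lpSymb φ l) ⊤ volume :=
    memLp_top_of_bound (continuous_lpSymb φ l).aestronglyMeasurable _
      (Eventually.of_forall (norm_lpSymb_le φ l))
  have h1 : lpProj φ l (𝓕⁻ (Lp.toTemperedDistribution f : 𝓢'(Euc d, ℂ))) =
      Lp.toTemperedDistribution (𝓕⁻ (hm.toLp _ • f : Lp (α := Euc d) ℂ 2 volume)) := by
    rw [lpProj, TemperedDistribution.fourierMultiplierCLM_apply, fourier_fourierInv_eq,
      ← Lp.fourierInv_toTemperedDistribution_eq,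
      Lp.toTemperedDistribution_smul_eq (hasTemperateGrowth_lpSymb φ l) hm f]
    rfl
  rw [h1, distNorm_eq aeInvariant_normL2 (isGivenBy_toTemperedDistribution _), normL2]
  have h2 : eLpNorm (𝓕⁻ (hm.toLp _ • f : Lp (α := Euc d) ℂ 2 volume) : Lp (α := Euc d) ℂ 2 volume)
      2 volume = eLpNorm (hm.toLp _ • f : Lp (α := Euc d) ℂ 2 volume) 2 volume := by
    have h3 : ‖𝓕⁻ (hm.toLp _ • f : Lp (α := Euc d) ℂ 2 volume)‖ =
        ‖(hm.toLp _ • f : Lp (α := Euc d) ℂ 2 volume)‖ := by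
      rw [← Lp.norm_fourier_eq, fourier_fourierInv_eq]
    rw [Lp.norm_def, Lp.norm_def] at h3
    exact (ENNReal.toReal_eq_toReal_iff' (Lp.eLpNorm_ne_top _) (Lp.eLpNorm_ne_top _)).1 h3
  rw [h2]
  refine eLpNorm_congr_ae ?_
  filter_upwards [Lp.coeFn_lpSMul (r := 2) (hm.toLp _) f, hm.coeFn_toLp] with x h4 h5
  rw [h4, Pi.smul_apply', h5, smul_eq_mul]

/-- The coefficients by which the Littlewood–Paley pieces decay. -/
def besovCoeff (l : ℤ) : ℝ := 2 * (2 : ℝ) ^ (-|(l : ℝ)| / 4)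

theorem besovCoeff_pos (l : ℤ) : 0 < besovCoeff l := by unfold besovCoeff; positivity

theorem summable_besovCoeff : Summable besovCoeff := by
  refine Summable.mul_left 2 ?_
  have h1 : Summable fun n : ℕ => ((2 : ℝ) ^ (-(1 / 4) : ℝ)) ^ n :=
    summable_geometric_of_lt_one (by positivity)
      (Real.rpow_lt_one_of_one_lt_of_neg one_lt_two (by norm_num))
  refine Summable.of_nat_of_neg (h1.congr fun n => ?_) (h1.congr fun n => ?_)
  all_goals
    rw [← Real.rpow_natCast, ← Real.rpow_mul two_pos.le]
    congr 1
    push_cast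
    simp
    ring

/-- For `l ≥ 0` the density is at least `2^(3(l-1)/2)` on the annulus, and `2 - l/2 + 3(l-1)/2 = l +
1/2`; the factor `2` in `besovCoeff` pays for the inner edge `2^(l-1)`. For `l < 0` the density is
at least `1`, and `l ≤ 2 - |l|/2`. -/
theorem two_rpow_le_besovCoeff_sq {d : ℕ} {l : ℤ} {ξ : Euc d} (hξ : ξ ∈ lpAnnulus d l) :
    (2 : ℝ) ^ (l : ℝ) ≤ besovCoeff l ^ 2 * sobDensity ξ := by
  have hsq : besovCoeff l ^ 2 = (2 : ℝ) ^ (2 - |(l : ℝ)| / 2) := by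
    rw [besovCoeff, mul_pow, ← Real.rpow_natCast _ 2, ← Real.rpow_natCast _ 2,
      ← Real.rpow_mul two_pos.le, ← Real.rpow_add two_pos]
    congr 1
    push_cast
    ring
  rw [hsq]
  rcases le_or_gt 0 (l : ℝ) with hl | hl
  · have hw : (2 : ℝ) ^ ((l : ℝ) - 1) ≤ freqWeight ξ := by
      have h1 := hξ.1
      rw [← Real.rpow_intCast] at h1
      push_cast at h1
      unfold freqWeight
      linarith
    have hs : (2 : ℝ) ^ (((l : ℝ) - 1) / 2) ≤ √(freqWeight ξ) := by
      refine Real.le_sqrt_of_sq_le ?_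
      rw [← Real.rpow_natCast _ 2, ← Real.rpow_mul two_pos.le]
      refine le_trans (le_of_eq ?_) hw
      congr 1
      push_cast
      ring
    calc (2 : ℝ) ^ (l : ℝ) ≤ (2 : ℝ) ^ (2 - |(l : ℝ)| / 2 + ((l : ℝ) - 1 + ((l : ℝ) - 1) / 2)) := by
          refine Real.rpow_le_rpow_of_exponent_le one_le_two ?_
          rw [abs_of_nonneg hl]
          linarith
      _ = (2 : ℝ) ^ (2 - |(l : ℝ)| / 2) *
          ((2 : ℝ) ^ ((l : ℝ) - 1) * (2 : ℝ) ^ (((l : ℝ) - 1) / 2)) := by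
          rw [Real.rpow_add two_pos, Real.rpow_add two_pos]
      _ ≤ _ := by
          unfold sobDensity
          gcongr
          linarith [one_le_freqWeight ξ]
  · calc (2 : ℝ) ^ (l : ℝ) ≤ (2 : ℝ) ^ (2 - |(l : ℝ)| / 2) := by
          refine Real.rpow_le_rpow_of_exponent_le one_le_two ?_
          rw [abs_of_neg hl]
          linarith
      _ ≤ _ := le_mul_of_one_le_right (by positivity) (one_le_sobDensity ξ)

theorem besov_piece_le {d : ℕ} {φ : 𝓢(Euc d, ℂ)}
    (hφ_supp : tsupport φ ⊆ Metric.closedBall 0 2)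
    (hφ_one : ∀ ξ : Euc d, ‖ξ‖ ≤ 1 → φ ξ = 1) (l : ℤ) (q : Lp ℂ 2 (sobMeasure d)) :
    ENNReal.ofReal ((2 : ℝ) ^ ((l : ℝ) / 2)) * distNorm normL2 (lpProj φ l (sobFourierInv d q)) ≤
      ENNReal.ofReal (besovCoeff l * (2 * SchwartzMap.seminorm ℝ 0 0 φ) * ‖q‖) := by
  set Mφ : ℝ := 2 * SchwartzMap.seminorm ℝ 0 0 φ with hMφ
  have hM0 : 0 ≤ Mφ := by positivity
  have hqm := memLp_volume_of_sobMeasure q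
  rw [sobFourierInv_apply, distNorm_lpProj_fourierInv]
  have h1 : eLpNorm (fun ξ => lpSymb φ l ξ * sobToLp d q ξ) 2 volume =
      eLpNorm (fun ξ => lpSymb φ l ξ * q ξ) 2 volume :=
    eLpNorm_congr_ae (by filter_upwards [hqm.coeFn_toLp] with ξ hξ; rw [sobToLp]; simp [hξ])
  rw [h1, ENNReal.ofReal_mul (by have := besovCoeff_pos l; positivity), Lp.norm_def,
    ENNReal.ofReal_toReal (Lp.eLpNorm_ne_top q)]
  refine (ENNReal.pow_le_pow_left_iff two_ne_zero).1 ?_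
  rw [mul_pow, mul_pow, eLpNorm_two_sq, eLpNorm_sobMeasure_sq hqm.1,
    ← lintegral_const_mul' _ _ (by finiteness), ← lintegral_const_mul' _ _ (by finiteness)]
  refine lintegral_mono fun ξ => ?_
  rw [enorm_mul, mul_pow, ← mul_assoc, ← mul_assoc]
  refine mul_le_mul_left ?_ _
  rw [← ofReal_norm, ← ENNReal.ofReal_pow (by positivity), ← ENNReal.ofReal_pow (norm_nonneg _),
    ← ENNReal.ofReal_pow (by have := besovCoeff_pos l; positivity),
    ← ENNReal.ofReal_mul (by positivity), ← ENNReal.ofReal_mul (by positivity)]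
  refine ENNReal.ofReal_le_ofReal ?_
  by_cases hξ : ξ ∈ lpAnnulus d l
  · have h2 : ((2 : ℝ) ^ ((l : ℝ) / 2)) ^ 2 = (2 : ℝ) ^ (l : ℝ) := by
      rw [← Real.rpow_natCast _ 2, ← Real.rpow_mul two_pos.le]
      congr 1
      push_cast
      ring
    rw [h2]
    calc _ ≤ besovCoeff l ^ 2 * sobDensity ξ * Mφ ^ 2 := by
          gcongr
          · have := one_le_sobDensity ξ
            positivity
          · exact two_rpow_le_besovCoeff_sq hξ
          · exact norm_lpSymb_le φ l ξ
      _ = _ := by ring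
  · rw [lpSymb_eq_zero hφ_supp hφ_one hξ, norm_zero]
    have := one_le_sobDensity ξ
    have : 0 ≤ (besovCoeff l * Mφ) ^ 2 * sobDensity ξ := by positivity
    simpa using this

theorem besovSeminorm_sobFourierInv_le {d : ℕ} {φ : 𝓢(Euc d, ℂ)}
    (hφ_supp : tsupport φ ⊆ Metric.closedBall 0 2)
    (hφ_one : ∀ ξ : Euc d, ‖ξ‖ ≤ 1 → φ ξ = 1) (q : Lp ℂ 2 (sobMeasure d)) :
    (besovSeminorm φ).toFun (sobFourierInv d q) ≤
      ENNReal.ofReal ((∑' l, besovCoeff l) * (2 * SchwartzMap.seminorm ℝ 0 0 φ) * ‖q‖) := by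
  refine (ENNReal.tsum_le_tsum fun l => besov_piece_le hφ_supp hφ_one l q).trans (le_of_eq ?_)
  have hs := (summable_besovCoeff.mul_right (2 * SchwartzMap.seminorm ℝ 0 0 φ)).mul_right ‖q‖
  rw [← ENNReal.ofReal_tsum_of_nonneg (fun l => ?_) hs, tsum_mul_right, tsum_mul_right]
  have := besovCoeff_pos l
  positivity

/-! ### Multiplication by a band limited function -/

/-- The cutoff is the inverse Fourier transform of a compactly supported Schwartz function. -/
theorem exists_fourierInv_eq_bandCutoff {d : ℕ} {θ : 𝓢(Euc d, ℝ)} (hθ : HasCompactSupport θ)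
    {a : ℝ} (ha : 0 < a) :
    ∃ κ : 𝓢(Euc d, ℂ), HasCompactSupport κ ∧
      bandCutoff θ a = ((𝓕⁻ κ : 𝓢(Euc d, ℂ)) : Euc d → ℂ) := by
  have hr : 2 * π / a ≠ 0 := by positivity
  let e : Euc d ≃L[ℝ] Euc d := ContinuousLinearEquiv.smulLeft (Units.mk0 (2 * π / a) hr)
  -- The dilation by `2π/a` turns the phase `a x·ξ` into `2π x·ξ`, and `(2π/a)^d` is its Jacobian.
  let c : ℂ := (((2 * π) ^ (-(d : ℝ) / 2) * (2 * π / a) ^ d : ℝ) : ℂ)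
  let κ : 𝓢(Euc d, ℂ) := c • SchwartzMap.compCLMOfContinuousLinearEquiv ℂ e
    (SchwartzMap.postcompCLM Complex.ofRealCLM θ)
  have hκ : ∀ ξ, κ ξ = c * (θ ((2 * π / a) • ξ) : ℂ) := fun ξ => rfl
  refine ⟨κ, ?_, ?_⟩
  · have h1 : HasCompactSupport fun ξ => θ ((2 * π / a) • ξ) :=
      hθ.comp_homeomorph e.toHomeomorph
    refine h1.mono fun ξ hξ h0 => hξ ?_
    rw [hκ]
    simp only at h0
    rw [h0]
    simp
  · ext x
    rw [SchwartzMap.fourierInv_coe, Real.fourierInv_eq', bandCutoff]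
    have h2 := Measure.integral_comp_smul (volume : Measure (Euc d))
      (fun ξ => Complex.exp (Complex.I * ((a * inner ℝ x ξ : ℝ) : ℂ)) * (θ ξ : ℂ)) (2 * π / a)
    have h3 : ∀ ξ : Euc d, Complex.exp ((↑(2 * π * inner ℝ ξ x) : ℂ) * Complex.I) • κ ξ =
        c * (Complex.exp (Complex.I * ((a * inner ℝ x ((2 * π / a) • ξ) : ℝ) : ℂ)) *
          (θ ((2 * π / a) • ξ) : ℂ)) := fun ξ => by
      rw [hκ, smul_eq_mul, inner_smul_right, real_inner_comm, mul_left_comm]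
      congr 3
      have ha' : (a : ℂ) ≠ 0 := by exact_mod_cast ha.ne'
      push_cast
      field_simp
    simp only [h3]
    rw [integral_const_mul, h2, finrank_euclideanSpace_fin, abs_of_pos (by positivity),
      Complex.real_smul, ← mul_assoc]
    congr 1
    simp only [c]
    rw [← Complex.ofReal_mul, mul_assoc, mul_inv_cancel₀ (by positivity), mul_one]

theorem norm_yStar_spec {d : ℕ} {φ : 𝓢(Euc d, ℂ)} {lam : ℝ} (u : YStar φ lam) :
    yStarSq φ lam ((yStarSeminorm φ lam).incl u) = ENNReal.ofReal ‖u‖ ^ 2 := by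
  have hbt : yStarSq φ lam ((yStarSeminorm φ lam).incl u) ^ (1 / 2 : ℝ) < ⊤ := u.2
  have hnorm : ‖u‖ = (yStarSq φ lam ((yStarSeminorm φ lam).incl u) ^ (1 / 2 : ℝ)).toReal := rfl
  rw [hnorm, ENNReal.ofReal_toReal hbt.ne, ← ENNReal.rpow_natCast, ← ENNReal.rpow_mul]
  norm_num

/-- The Fourier transform of the product with a band limited function, as a linear map. -/
def bandFourierLin {d : ℕ} (φ : 𝓢(Euc d, ℂ)) (lam : ℝ) (κ : 𝓢(Euc d, ℂ)) :
    YStar φ lam →ₗ[ℂ] (Euc d → ℂ) where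
  toFun u := bandFourier κ ((yStarSeminorm φ lam).incl u)
  map_add' u v := by
    ext ξ
    simp only [bandFourier, _root_.map_add, FourierTransform.fourier_add]
    rfl
  map_smul' c u := by
    ext ξ
    simp only [bandFourier, _root_.map_smul, FourierTransform.fourier_smul]
    rfl

/-- The squared weight exceeds the density by `(1 + 2π|ξ|)^(1/2)`. This gain at infinity is the
source of the compactness. -/
theorem sobDensity_mul_le {d : ℕ} {M : ℝ} (hM : 0 ≤ M) {ξ : Euc d} (hξ : M ≤ ‖ξ‖) :
    √(1 + M) * sobDensity ξ ≤ freqWeight ξ ^ 2 := by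
  have h0 := one_le_freqWeight ξ
  have h1 : 1 + M ≤ freqWeight ξ := by
    unfold freqWeight
    nlinarith [Real.pi_gt_three, norm_nonneg ξ]
  calc _ ≤ √(freqWeight ξ) * (freqWeight ξ * √(freqWeight ξ)) := by
        unfold sobDensity
        gcongr
    _ = freqWeight ξ * (√(freqWeight ξ) * √(freqWeight ξ)) := by ring
    _ = _ := by rw [Real.mul_self_sqrt (by linarith)]; ring

/-- The part of a function outside a ball is small in the weighted space, if the function has one
derivative in `L²`. -/
theorem eLpNorm_sobMeasure_compl_ball_le {d : ℕ} {g : Euc d → ℂ} (hg : Continuous g) {M : ℝ}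
    (hM : 0 ≤ M) {s : Set (Euc d)} (hsm : MeasurableSet s) (hs : ∀ ξ ∈ s, M ≤ ‖ξ‖) :
    ENNReal.ofReal √(1 + M) * eLpNorm (s.indicator g) 2 (sobMeasure d) ^ 2 ≤
      ∫⁻ ξ, ENNReal.ofReal (freqWeight ξ) ^ 2 * ‖g ξ‖ₑ ^ 2 := by
  rw [eLpNorm_sobMeasure_sq (hg.aestronglyMeasurable.indicator hsm),
    ← lintegral_const_mul' _ _ (by finiteness)]
  refine lintegral_mono fun ξ => ?_
  by_cases hξ : ξ ∈ s
  · rw [Set.indicator_of_mem hξ, ← mul_assoc, ← ENNReal.ofReal_mul (by positivity),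
      ← ENNReal.ofReal_pow (zero_le_one.trans (one_le_freqWeight ξ))]
    exact mul_le_mul_left (ENNReal.ofReal_le_ofReal (sobDensity_mul_le hM (hs ξ hξ))) _
  · simp [Set.indicator_of_notMem hξ]

theorem continuous_bandFourierLin {d : ℕ} {φ : 𝓢(Euc d, ℂ)}
    (hφ_supp : tsupport φ ⊆ Metric.closedBall 0 2)
    (hφ_one : ∀ ξ : Euc d, ‖ξ‖ ≤ 1 → φ ξ = 1) {lam : ℝ} (hlam : 1 < lam)
    {κ : 𝓢(Euc d, ℂ)} (hκ : HasCompactSupport κ) (u : YStar φ lam) :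
    Continuous (bandFourierLin φ lam κ u) := by
  obtain ⟨C, hC, h⟩ := exists_bandFourier_bounds hφ_supp hφ_one hlam hκ
  refine (LipschitzWith.of_dist_le_mul (K := ⟨C * ‖u‖, by positivity⟩) fun ξ ξ' => ?_).continuous
  rw [dist_eq_norm, dist_eq_norm]
  exact (h u).2 ξ ξ'

/-- Stated for a general set so as to give both boundedness (the whole space, `M = 0`) and the decay
of the tails (the complement of a ball). -/
theorem exists_eLpNorm_bandFourierLin_le {d : ℕ} {φ : 𝓢(Euc d, ℂ)}
    (hφ_supp : tsupport φ ⊆ Metric.closedBall 0 2)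
    (hφ_one : ∀ ξ : Euc d, ‖ξ‖ ≤ 1 → φ ξ = 1) {lam : ℝ} (hlam : 1 < lam)
    {κ : 𝓢(Euc d, ℂ)} (hκ : HasCompactSupport κ) :
    ∃ C : ℝ, 0 ≤ C ∧ ∀ (u : YStar φ lam) (M : ℝ), 0 ≤ M → ∀ s : Set (Euc d), MeasurableSet s →
      (∀ ξ ∈ s, M ≤ ‖ξ‖) →
      ENNReal.ofReal √(1 + M) *
        eLpNorm (s.indicator (bandFourierLin φ lam κ u)) 2 (sobMeasure d) ^ 2 ≤
          ENNReal.ofReal (C * ‖u‖) ^ 2 := by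
  obtain ⟨C, hC, h⟩ := exists_lintegral_bandFourier_le hφ_supp hφ_one hlam hκ
  refine ⟨√C.toReal, by positivity, fun u M hM s hsm hs => ?_⟩
  refine (eLpNorm_sobMeasure_compl_ball_le (continuous_bandFourierLin hφ_supp hφ_one hlam hκ u)
    hM hsm hs).trans ?_
  have hu := norm_yStar_spec u
  refine (h _ (by rw [hu]; finiteness)).trans (le_of_eq ?_)
  rw [hu, ENNReal.ofReal_mul (by positivity), mul_pow, ← ENNReal.ofReal_pow (Real.sqrt_nonneg _),
    Real.sq_sqrt ENNReal.toReal_nonneg, ENNReal.ofReal_toReal hC.ne]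

/-- Multiplication by a band limited function, in terms of Fourier transforms, is compact to the
weighted space. -/
theorem exists_compact_bandFourier {d : ℕ} {φ : 𝓢(Euc d, ℂ)}
    (hφ_supp : tsupport φ ⊆ Metric.closedBall 0 2)
    (hφ_one : ∀ ξ : Euc d, ‖ξ‖ ≤ 1 → φ ξ = 1) {lam : ℝ} (hlam : 1 < lam)
    {κ : 𝓢(Euc d, ℂ)} (hκ : HasCompactSupport κ) :
    ∃ S : YStar φ lam →L[ℂ] Lp ℂ 2 (sobMeasure d),
      (∀ u, S u =ᵐ[sobMeasure d] bandFourier κ ((yStarSeminorm φ lam).incl u)) ∧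
        IsCompactOperator S := by
  obtain ⟨C, hC, h⟩ := exists_eLpNorm_bandFourierLin_le hφ_supp hφ_one hlam hκ
  obtain ⟨K, hK, hb⟩ := exists_bandFourier_bounds hφ_supp hφ_one hlam hκ
  have hbd : ∀ u : YStar φ lam, eLpNorm (bandFourierLin φ lam κ u) 2 (sobMeasure d) ≤
      ENNReal.ofReal (C * ‖u‖) := fun u => by
    have h1 := h u 0 le_rfl Set.univ MeasurableSet.univ fun ξ _ => norm_nonneg ξ
    rw [add_zero, Real.sqrt_one, ENNReal.ofReal_one, one_mul, Set.indicator_univ] at h1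
    exact (ENNReal.pow_le_pow_left_iff two_ne_zero).1 h1
  have hmem : ∀ u : YStar φ lam, MemLp (bandFourierLin φ lam κ u) 2 (sobMeasure d) := fun u =>
    ⟨(continuous_bandFourierLin hφ_supp hφ_one hlam hκ u).aestronglyMeasurable,
      (hbd u).trans_lt ENNReal.ofReal_lt_top⟩
  let S₀ : YStar φ lam →ₗ[ℂ] Lp ℂ 2 (sobMeasure d) :=
    { toFun := fun u => (hmem u).toLp _
      map_add' := fun u v => by
        rw [← MemLp.toLp_add]
        exact MemLp.toLp_congr _ _ (by rw [_root_.map_add])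
      map_smul' := fun c u => by
        rw [RingHom.id_apply, ← MemLp.toLp_const_smul]
        exact MemLp.toLp_congr _ _ (by rw [_root_.map_smul]) }
  let S : YStar φ lam →L[ℂ] Lp ℂ 2 (sobMeasure d) := S₀.mkContinuous C fun u => by
    change ‖(hmem u).toLp _‖ ≤ _
    rw [Lp.norm_toLp]
    exact ENNReal.toReal_le_of_le_ofReal (by positivity) (hbd u)
  have hS : ∀ u, S u =ᵐ[sobMeasure d] bandFourierLin φ lam κ u := fun u => (hmem u).coeFn_toLp
  refine ⟨S, hS, isCompactOperator_of_tail (bandFourierLin φ lam κ) hK (fun u => (hb u).1)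
    (fun u => (hb u).2) (fun ε hε => ?_) S hS⟩
  -- With this radius `√(1 + M) ≥ C² / ε²`, which turns the factor `C` into `ε`.
  set M : ℝ := (C ^ 2 / ε ^ 2) ^ 2 with hM
  refine ⟨M, fun u => ?_⟩
  have h1 := h u M (by positivity) (Metric.closedBall 0 M)ᶜ Metric.isClosed_closedBall.measurableSet.compl
    fun ξ hξ => by
      rw [Set.mem_compl_iff, mem_closedBall_zero_iff, not_le] at hξ
      exact hξ.le
  refine (ENNReal.pow_le_pow_left_iff two_ne_zero).1 ?_
  have hpos : 0 < √(1 + M) := by positivity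
  have hM2 : C ^ 2 ≤ √(1 + M) * ε ^ 2 := by
    rw [← div_le_iff₀ (by positivity)]
    exact Real.le_sqrt_of_sq_le (by linarith)
  have h2 : ENNReal.ofReal (C * ‖u‖) ^ 2 ≤
      ENNReal.ofReal √(1 + M) * ENNReal.ofReal (ε * ‖u‖) ^ 2 := by
    rw [← ENNReal.ofReal_pow (by positivity), ← ENNReal.ofReal_pow (by positivity),
      ← ENNReal.ofReal_mul hpos.le]
    refine ENNReal.ofReal_le_ofReal ?_
    rw [mul_pow, mul_pow, ← mul_assoc]
    gcongr
  exact (ENNReal.mul_le_mul_iff_right (by simpa using hpos) (by finiteness)).1 (h1.trans h2)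

/-- The weighted space contains the product of a distribution in `YStar` with a band limited
function. -/
theorem sobFourierInv_eq_smulLeftCLM {d : ℕ} {φ : 𝓢(Euc d, ℂ)}
    (hφ_supp : tsupport φ ⊆ Metric.closedBall 0 2)
    (hφ_one : ∀ ξ : Euc d, ‖ξ‖ ≤ 1 → φ ξ = 1) {lam : ℝ} (hlam : 1 < lam)
    {κ : 𝓢(Euc d, ℂ)} (hκ : HasCompactSupport κ) {u : 𝓢'(Euc d, ℂ)}
    (hu : yStarSq φ lam u < ⊤) {q : Lp ℂ 2 (sobMeasure d)}
    (hq : q =ᵐ[sobMeasure d] bandFourier κ u) :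
    sobFourierInv d q =
      TemperedDistribution.smulLeftCLM ℂ ((𝓕⁻ κ : 𝓢(Euc d, ℂ)) : Euc d → ℂ) u := by
  have h1 : 𝓕 (TemperedDistribution.smulLeftCLM ℂ ((𝓕⁻ κ : 𝓢(Euc d, ℂ)) : Euc d → ℂ) u) =
      Lp.toTemperedDistribution (sobToLp d q) := by
    refine (TemperedDistribution.ext_of_hasCompactSupport fun f hf => ?_).symm
    -- With `χ = 𝓕⁻ κ`, the computation is `𝓕(χ u)(f) = u(χ 𝓕 f) = û(bandConv κ f) = ∫ f ·
    -- bandFourier κ u`.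
    have h2 : 𝓕 (bandConv κ f) = SchwartzMap.smulLeftCLM ℂ ((𝓕⁻ κ : 𝓢(Euc d, ℂ)) : Euc d → ℂ)
        (𝓕 f) := by rw [bandConv, fourier_fourierInv_eq]
    rw [TemperedDistribution.fourier_apply, TemperedDistribution.smulLeftCLM_apply_apply, ← h2,
      ← TemperedDistribution.fourier_apply, (bandFubini_fourier hφ_supp hφ_one hlam hu hκ hf).2,
      Lp.toTemperedDistribution_apply]
    refine integral_congr_ae ?_
    have hae := (volume_le_sobMeasure d).absolutelyContinuous.ae_le hq
    filter_upwards [hae, (memLp_volume_of_sobMeasure q).coeFn_toLp] with ξ h3 h4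
    rw [sobToLp]
    simp [h4, h3, bandFourier]
  rw [sobFourierInv_apply, ← h1, fourierInv_fourier_eq]

/-- The product factors as `J ∘ S`: `S` sends `u` compactly to the Fourier transform of `χ u` in the
weighted space, and `J` is the bounded inverse Fourier transform into the Besov space. -/
theorem exists_compact_mul_bandCutoff {d : ℕ} {φ : 𝓢(Euc d, ℂ)}
    (hφ_supp : tsupport φ ⊆ Metric.closedBall 0 2)
    (hφ_one : ∀ ξ : Euc d, ‖ξ‖ ≤ 1 → φ ξ = 1) {lam : ℝ} (hlam : 1 < lam)
    {θ : 𝓢(Euc d, ℝ)} (hθ : HasCompactSupport θ) {a : ℝ} (ha : 0 < a) :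
    ∃ T : YStar φ lam →L[ℂ] HomBesov φ,
      (∀ u : YStar φ lam, (besovSeminorm φ).incl (T u) =
        TemperedDistribution.smulLeftCLM ℂ (bandCutoff θ a) ((yStarSeminorm φ lam).incl u)) ∧
      IsCompactOperator T := by
  obtain ⟨κ, hκ, hκa⟩ := exists_fourierInv_eq_bandCutoff hθ ha
  obtain ⟨S, hS, hSc⟩ := exists_compact_bandFourier hφ_supp hφ_one hlam hκ
  let J := (besovSeminorm φ).lift (sobFourierInv d) _ (besovSeminorm_sobFourierInv_le hφ_supp hφ_one)
  refine ⟨J.comp S, fun u => ?_, hSc.clm_comp J⟩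
  rw [hκa]
  exact sobFourierInv_eq_smulLeftCLM hφ_supp hφ_one hlam hκ
    (by rw [norm_yStar_spec]; finiteness) (hS u)

end

theorem mainTheorem7 (d : ℕ) (hd : 2 ≤ d)
    -- the function from which the Littlewood-Paley projectors are built
    (φ : 𝓢(Euc d, ℂ)) (hφ_supp : tsupport φ ⊆ Metric.closedBall 0 2)
    (hφ_one : ∀ ξ : Euc d, ‖ξ‖ ≤ 1 → φ ξ = 1)
    -- the function and the parameters from which the cutoff is built
    (θ : 𝓢(Euc d, ℝ)) (hθ_range : ∀ ξ, θ ξ ∈ Set.Icc (0 : ℝ) 1)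
    (hθ_supp : tsupport θ ⊆ Metric.closedBall 0 1) (hθ_ne : θ ≠ 0)
    (δ : ℝ) (hδ : δ ∈ Set.Ioc (0 : ℝ) 1)
    (hδ_lower : ∀ x : Euc d, ‖x‖ ≤ δ →
      (1 / 2 : ℝ) * ∫ ξ, θ ξ ≤
        ‖∫ ξ, Complex.exp (Complex.I * ((inner ℝ x ξ : ℝ) : ℂ)) * (θ ξ : ℂ)‖)
    (R : ℝ) (hR : 1 ≤ R)
    (lam : ℝ) (hlam : 1 < lam) :
    ∃ T : YStar φ lam →L[ℂ] HomBesov φ,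
      (∀ u : YStar φ lam,
        (besovSeminorm φ).incl (T u) =
          TemperedDistribution.smulLeftCLM ℂ (bandCutoff θ (δ / R))
            ((yStarSeminorm φ lam).incl u)) ∧
      IsCompactOperator T := by
  refine exists_compact_mul_bandCutoff hφ_supp hφ_one hlam ?_ (div_pos hδ.1 (by linarith))
  exact (isCompact_closedBall _ _).of_isClosed_subset (isClosed_tsupport _) hθ_supp
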